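/- **Definitions.** For a tuple $\epsilon=(\epsilon(1),\dots,\epsilon(t))$ of non-negative integers and a sequence $Q=(Q_1,Q_2,\dots)$ put $\epsilon * Q=\sum_{k=1}^t\epsilon(k)Q_{t-k+1}$ and $\epsilon\cdot Q=\sum_{k=1}^t\epsilon(k)Q_k$; write $\epsilon|s=(\epsilon(1),\dots,\epsilon(s))$ and $\mathrm{len}(\epsilon)=t$. Let $L=(a_1,\dots,a_N)$ be a tuple of non-negative integers with $N\ge 2$ and $a_1>0$, and let $\Theta=(a_1,\dots,a_N,a_1,\dots,a_N,\dots)$ be its periodic repetition. Let $\mathcal H^\circ$ be the recursively defined set of finite tuples $\epsilon$ such that, for some $s\ge 0$, $\epsilon|s=\Theta|s$ and either $s=\mathrm{len}(\epsilon)$, or $\epsilon(s+1)<\Theta(s+1)$ and $(\epsilon(s+2),\dots,\epsilon(\mathrm{len}(\epsilon)))\in\mathcal H^\circ$. The set $\mathcal H=\{\epsilon\in\mathcal H^\circ:\epsilon(1)>0\}$ is the *periodic Zeckendorf collection* with principal maximal block $L$. It has a unique *fundamental sequence* $H$: an increasing sequence of positive integers such that every positive integer $n$ equals $\epsilon*H$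 for exactly one $\epsilon\in\mathcal H$ (the *$\mathcal H$-expansion* of $n$). The polynomial $x^N-\sum_{k=1}^{N-1}a_kx^{N-k}-(1+a_N)$ has a unique *dominant real zero* $\psi=\psi_{\mathcal H}$, i.e. a real zero larger in absolute value than every other complex zero. Let $\widehat H_n=\psi^{-(n-1)}$. Let $s\ge 1$. If $n=\epsilon*H$ with $\epsilon\in\mathcal H$ and $\mathrm{len}(\epsilon)\ge s$, the leading block of $n$ of length $s$ is $\epsilon|s$, and $\mathrm{LB}_s(n)$ is $\epsilon|s$ if $s\ge N$ and $(\epsilon(1),\dots,\epsilon(s),0,\dots,0)\in\mathbb N_0^N$ if $s<N$; it is undefined if $\mathrm{len}(\epsilon)<s$. Let $\mathcal H_s$ be the set of leading blocks of length $s$ (if $s\ge N$), respectively of leading blocks of length $N$ whose entries after the $s$-th vanish (if $s<N$), of positive integers. For $\mathbf b\in\mathcal H_s$ let $\widetilde{\mathbf b}$ be the block $\mathbf c\in\mathcal H_s$ with $1+(\mathbf b|s)*H=(\mathbf c|s)*H$; if there is none, i.e. if $\mathbf b$ is the largest block in $\mathcal H_s$, let $\widetilde{\mathbf b}$ be $\Theta|(t-p)$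 with its last entry increased by $1$, followed by $p$ zeros, where $t=\max(s,N)$ and $p$ is the remainder of $t$ modulo $N$. A sequence $K=(K_1,K_2,\dots)$ of positive integers satisfies *strong Benford's Law under $\mathcal H$-expansion* if for all $s\ge 1$ and all $\mathbf b\in\mathcal H_s$ $$\lim_{n\to\infty}\frac{\#\{1\le k\le n:\mathrm{LB}_s(K_k)=\mathbf b\}}{n}=\log_\psi\frac{\widetilde{\mathbf b}\cdot\widehat H}{\mathbf b\cdot\widehat H},$$ the limit being asserted to exist. It satisfies *absolute Benford's Law* if it satisfies strong Benford's Law under $\mathcal H$-expansion for every periodic Zeckendorf collection $\mathcal H$. **Theorem.** (i) Let $\gamma>1$ be a real number such that $\gamma\ne\psi_{\mathcal H}^{\,r}$ for every periodic Zeckendorf collection $\mathcal H$ and every $r\in\mathbb Q$. Then the sequence $K_n=\lfloor\gamma^n\rfloor$, $n\ge 1$, satisfies absolute Benford's Law. (ii) If $\gamma>1$ is a real number that is not an algebraic integer, then $K_n=\lfloor\gamma^n\rfloor$ satisfies absolute Benford's Law. (iii) In particular, $K_n=\lfloor(89/55)^n\rfloor$ satisfies absolute Benford's Law. -/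

import Mathlib

open Filter Topology

namespace GenZeckendorf

/-! Finite tuples of natural numbers are lists.  Sequences `Q_1, Q_2, ...` are functions on `ℕ`
with the index shifted by one: `Q k` is the mathematical `Q_{k+1}`.  In the same way
`ε.getD k 0` is the mathematical entry `ε(k+1)` of a tuple `ε`. -/

/-- The product `ε * Q = ∑_{k=1}^{t} ε(k) Q_{t-k+1}`, where `t = len ε`. -/
def conv (ε : List ℕ) (Q : ℕ → ℕ) : ℕ :=
  ∑ k ∈ Finset.range ε.length, ε.getD k 0 * Q (ε.length - 1 - k)

/-- The product `ε · Q = ∑_{k=1}^{t} ε(k) Q_k`, where `t = len ε`. -/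
noncomputable def dot (ε : List ℕ) (Q : ℕ → ℝ) : ℝ :=
  ∑ k ∈ Finset.range ε.length, (ε.getD k 0 : ℝ) * Q k

/-- The tuples `L = (a_1, ..., a_N)` with `N ≥ 2` and `a_1 > 0`. -/
def IsPrincipalMaximalBlock (L : List ℕ) : Prop :=
  2 ≤ L.length ∧ 0 < L.getD 0 0

/-- The infinite periodic tuple `Θ = (a_1, ..., a_N, a_1, ..., a_N, ...)`. -/
def theta (L : List ℕ) (k : ℕ) : ℕ := L.getD (k % L.length) 0

/-- The truncation `Θ|s = (Θ(1), ..., Θ(s))`. -/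
def thetaTrunc (L : List ℕ) (s : ℕ) : List ℕ := (List.range s).map (theta L)

/-- The recursively defined set `𝓗°`: a tuple belongs to it iff it is `Θ|s` for some `s ≥ 0`, or it
agrees with `Θ` in its first `s` entries, has a smaller entry than `Θ` in the next place, and the
remaining tuple (possibly empty) belongs to `𝓗°`.  The number `s` is determined by the tuple. -/
inductive MemHcirc (L : List ℕ) : List ℕ → Prop
  | trunc (s : ℕ) : MemHcirc L (thetaTrunc L s)
  | step (s c : ℕ) (τ : List ℕ) (hc : c < theta L s) (hτ : MemHcirc L τ) :
      MemHcirc L (thetaTrunc L s ++ c :: τ)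

/-- The periodic Zeckendorf collection `𝓗 = {ε ∈ 𝓗° : ε(1) > 0}` with principal maximal
block `L`. -/
def collection (L : List ℕ) : Set (List ℕ) :=
  {ε | MemHcirc L ε ∧ 0 < ε.getD 0 0}

/-- `H` is a fundamental sequence of a set `𝓗` of coefficient functions: an increasing sequence of
positive integers such that each positive integer is `ε * H` for exactly one `ε ∈ 𝓗`. -/
def IsFundamentalSequence (𝓗 : Set (List ℕ)) (H : ℕ → ℕ) : Prop :=
  StrictMono H ∧ (∀ k, 0 < H k) ∧ ∀ n : ℕ, 0 < n → ∃! ε : List ℕ, ε ∈ 𝓗 ∧ conv ε H = n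

/-- The polynomial `g = x^N - ∑_{k=1}^{N-1} a_k x^{N-k} - (1 + a_N)`. -/
noncomputable def charPoly (L : List ℕ) : Polynomial ℤ :=
  Polynomial.X ^ L.length
    - ∑ k ∈ Finset.range (L.length - 1),
        Polynomial.C (L.getD k 0 : ℤ) * Polynomial.X ^ (L.length - 1 - k)
    - Polynomial.C (1 + (L.getD (L.length - 1) 0 : ℤ))

/-- `ψ` is the dominant real zero of `g`: a real zero whose absolute value is larger than that of
every other complex zero. -/
def IsDominantRealZero (L : List ℕ) (ψ : ℝ) : Prop :=
  Polynomial.aeval ψ (charPoly L) = 0 ∧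
    ∀ z : ℂ, Polynomial.aeval z (charPoly L) = 0 → z ≠ (ψ : ℂ) → ‖z‖ < |ψ|

/-- The sequence `Ĥ = (1, ψ⁻¹, ψ⁻², ...)`. -/
noncomputable def hatSeq (ψ : ℝ) (k : ℕ) : ℝ := ψ⁻¹ ^ k

/-- `b` is the leading block of length `t` in the `𝓗`-expansion of `n`
(there is none if the expansion has fewer than `t` entries). -/
def IsLeadingBlock (L : List ℕ) (H : ℕ → ℕ) (t n : ℕ) (b : List ℕ) : Prop :=
  ∃ ε ∈ collection L, conv ε H = n ∧ t ≤ ε.length ∧ b = ε.take t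

/-- `LB_s(n)` is defined and equal to `b`: the leading block of length `s` of `n`, filled up with
zeros to length `N` if `s < N` (the subtraction is truncated, so nothing is added if `s ≥ N`). -/
def LBEq (L : List ℕ) (H : ℕ → ℕ) (s n : ℕ) (b : List ℕ) : Prop :=
  ∃ c : List ℕ, IsLeadingBlock L H s n c ∧ b = c ++ List.replicate (L.length - s) 0

/-- The set `𝓗_s`: the leading blocks of length `s` (if `s ≥ N`), respectively the leading blocks of
length `N` whose entries after the `s`-th are zero (if `s < N`), that occur in the `𝓗`-expansions
of positive integers. -/
def blocks (L : List ℕ) (H : ℕ → ℕ) (s : ℕ) : Set (List ℕ) :=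
  {b | (∃ n : ℕ, 0 < n ∧ IsLeadingBlock L H (max s L.length) n b) ∧
    ∀ j : ℕ, s ≤ j → b.getD j 0 = 0}

/-- The exclusive block.  With `t = max s N` and `p = t mod N`, it is `Θ|(t-p)` with its last entry
`a_N` increased by one, followed by `p` zeros; for `s < N` it is `(a_1, ..., a_{N-1}, 1 + a_N)`. -/
def exclusiveBlock (L : List ℕ) (s : ℕ) : List ℕ :=
  thetaTrunc L (L.length * (max s L.length / L.length) - 1)
    ++ (1 + L.getD (L.length - 1) 0) :: List.replicate (max s L.length % L.length) 0

open scoped Classical in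
/-- The block `b̃`: the block `c` in `𝓗_s` with `1 + b|s * H = c|s * H`, or the exclusive block if
there is none, i.e. if `b` is the largest leading block in `𝓗_s`. -/
noncomputable def tilde (L : List ℕ) (H : ℕ → ℕ) (s : ℕ) (b : List ℕ) : List ℕ :=
  if h : ∃ c ∈ blocks L H s, 1 + conv (b.take s) H = conv (c.take s) H then h.choose
  else exclusiveBlock L s

open scoped Classical in
/-- `Prob {n ∈ {1, 2, 3, ...} : P n} = p`; the existence of the limit is part of the claim. -/
def HasProb (P : ℕ → Prop) (p : ℝ) : Prop :=
  Tendsto (fun n : ℕ => (((Finset.Icc 1 n).filter P).card : ℝ) / (n : ℝ)) atTop (𝓝 p)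

/-- `K_1, K_2, ...` (here `K n` is `K_n`; the value `K 0` plays no role) satisfies strong Benford's
Law under `𝓗`-expansion, where `𝓗` is the periodic Zeckendorf collection with principal maximal
block `L`.  The fundamental sequence and the dominant real zero are unique; that they exist is made
part of the property, so that it cannot hold vacuously. -/
def StrongBenford (L : List ℕ) (K : ℕ → ℕ) : Prop :=
  (∃ H : ℕ → ℕ, IsFundamentalSequence (collection L) H) ∧
  (∃ ψ : ℝ, IsDominantRealZero L ψ) ∧
  ∀ H : ℕ → ℕ, IsFundamentalSequence (collection L) H →
    ∀ ψ : ℝ, IsDominantRealZero L ψ →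
      ∀ s : ℕ, 1 ≤ s → ∀ b ∈ blocks L H s,
        HasProb (fun n => LBEq L H s (K n) b)
          (Real.logb ψ (dot (tilde L H s b) (hatSeq ψ) / dot b (hatSeq ψ)))

/-- Absolute Benford's Law, for sequences of positive integers: strong Benford's Law under every
periodic Zeckendorf collection. -/
def AbsoluteBenford (K : ℕ → ℕ) : Prop :=
  (∀ n : ℕ, 1 ≤ n → 0 < K n) ∧
  ∀ L : List ℕ, IsPrincipalMaximalBlock L → StrongBenford L K

end GenZeckendorf

namespace GenZeckendorf

/-! ### Convolution products -/

/-! Fix one collection. `𝓗°` is the language of an automaton whose state counts the entries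
currently agreeing with `Θ`. Among words of equal length read from the same state, order by value is
lexicographic order, and the words of length `t` take each value in `[0, H_t)` once, with `H`
indexed from zero (`fundSeq`). Hence the numbers with `s + j` digits and a given leading block `b`
form an interval `[x_j, y_j)`: `x_j` is `b|s` padded by `j` zeros, and `y_j` is the padded successor
block, or `H_{s+j}` if `b` is largest (`lBEq_iff`).

After division by `ψ^t`, the recursion of `H` replaces each term by a weighted average of the `N`
previous ones, the latest having positive weight. So `H_t / ψ^t` tends to some `α > 0`
(`exists_tendsto_fundSeq_div`), and `x_j / ψ^j`, `y_j / ψ^j` tend to `α ψ^(s-1)` times `b · Ĥ` and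
`b̃ · Ĥ`. The exclusive block is designed to have product `ψ` with `Ĥ` (`dot_exclusiveBlock`), so
the largest block is no exception.

On the `log_ψ` scale the intervals thus approach the integer translates of a single interval of
length `log_ψ (b̃ · Ĥ / b · Ĥ) ≤ 1`. The floor is harmless because the endpoints are integers, so
the question is how often `n log_ψ γ` modulo one falls in an arc. The hypothesis on `γ` makes `log_ψ
γ` irrational, and Weyl equidistribution gives the length of the arc
(`hasProb_exists_floor_pow_mem`).

For the second claim, `ψ` is a zero of a monic integer polynomial; a rational power of `ψ` exceeding
one has positive exponent and is again an algebraic integer. The third holds since `89/55` is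
rational but not an integer. -/

lemma conv_nil (Q : ℕ → ℕ) : conv [] Q = 0 := by simp [conv]

lemma conv_cons (c : ℕ) (τ : List ℕ) (Q : ℕ → ℕ) :
    conv (c :: τ) Q = c * Q τ.length + conv τ Q := by
  unfold conv
  rw [List.length_cons, Finset.sum_range_succ', add_comm]
  congr 1
  refine Finset.sum_congr rfl fun k _ => ?_
  rw [List.getD_cons_succ]
  congr 2
  omega

lemma conv_append (σ τ : List ℕ) (Q : ℕ → ℕ) :
    conv (σ ++ τ) Q = conv σ (fun k => Q (k + τ.length)) + conv τ Q := by
  induction σ with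
  | nil => simp [conv_nil]
  | cons c σ ih => simp [conv_cons, ih, add_assoc]

lemma conv_replicate_zero (n : ℕ) (Q : ℕ → ℕ) : conv (List.replicate n 0) Q = 0 := by
  induction n with
  | zero => simp [conv_nil]
  | succ n ih => simp [List.replicate_succ, conv_cons, ih]

lemma conv_congr {ε : List ℕ} {Q R : ℕ → ℕ} (h : ∀ k < ε.length, Q k = R k) :
    conv ε Q = conv ε R := by
  unfold conv
  refine Finset.sum_congr rfl fun k hk => ?_
  rw [Finset.mem_range] at hk
  rw [h _ (by omega)]

lemma conv_take_append_zeros_le (ε : List ℕ) (s : ℕ) (Q : ℕ → ℕ) :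
    conv (ε.take s ++ List.replicate (ε.length - s) 0) Q ≤ conv ε Q := by
  conv_rhs => rw [← List.take_append_drop s ε]
  rw [conv_append, conv_append, conv_replicate_zero]
  simp

lemma le_conv_of_pos {ε : List ℕ} (hε : 0 < ε.getD 0 0) (Q : ℕ → ℕ) :
    0 < ε.length ∧ Q (ε.length - 1) ≤ conv ε Q := by
  cases ε with
  | nil => simp at hε
  | cons c τ =>
    simp only [List.getD_cons_zero] at hε
    refine ⟨by simp, ?_⟩
    rw [conv_cons]
    simp only [List.length_cons, Nat.add_sub_cancel]
    nlinarith [Nat.zero_le (Q τ.length), Nat.zero_le (conv τ Q)]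

/-! ### The collection `𝓗°` as the language of an automaton -/

/-- `Accepts L r ε` says that a word of `𝓗°` may continue with `ε` after exactly `r` entries that
agree with `Θ`. -/
def Accepts (L : List ℕ) : ℕ → List ℕ → Prop
  | _, [] => True
  | r, c :: τ => (c = theta L r ∧ Accepts L (r + 1) τ) ∨ (c < theta L r ∧ Accepts L 0 τ)

lemma thetaTrunc_succ (L : List ℕ) (s : ℕ) :
    thetaTrunc L (s + 1) = thetaTrunc L s ++ [theta L s] := by
  simp [thetaTrunc, List.range_succ]

lemma length_thetaTrunc (L : List ℕ) (s : ℕ) : (thetaTrunc L s).length = s := by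
  simp [thetaTrunc]

lemma accepts_thetaTrunc_append {L : List ℕ} (s : ℕ) {τ : List ℕ} (h : Accepts L s τ) :
    Accepts L 0 (thetaTrunc L s ++ τ) := by
  induction s generalizing τ with
  | zero => simpa [thetaTrunc] using h
  | succ s ih =>
    rw [thetaTrunc_succ, List.append_assoc]
    exact ih (Or.inl ⟨rfl, h⟩)

lemma memHcirc_of_accepts {L : List ℕ} (ε : List ℕ) (r : ℕ) (h : Accepts L r ε) :
    MemHcirc L (thetaTrunc L r ++ ε) := by
  induction ε generalizing r with
  | nil => simpa using MemHcirc.trunc r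
  | cons c τ ih =>
    rcases h with ⟨rfl, h⟩ | ⟨hc, h⟩
    · have := ih (r + 1) h
      rwa [thetaTrunc_succ, List.append_assoc] at this
    · exact MemHcirc.step r c τ hc (by simpa [thetaTrunc] using ih 0 h)

lemma memHcirc_iff {L ε : List ℕ} : MemHcirc L ε ↔ Accepts L 0 ε := by
  constructor
  · intro h
    induction h with
    | trunc s => simpa using accepts_thetaTrunc_append (L := L) s (τ := []) trivial
    | step s c τ hc _ ih => exact accepts_thetaTrunc_append s (Or.inr ⟨hc, ih⟩)
  · intro h
    simpa [thetaTrunc] using memHcirc_of_accepts ε 0 h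

lemma accepts_take {L : List ℕ} {r : ℕ} {ε : List ℕ} (h : Accepts L r ε) (s : ℕ) :
    Accepts L r (ε.take s) := by
  induction ε generalizing r s with
  | nil => simpa using h
  | cons c τ ih =>
    cases s with
    | zero => simp [Accepts]
    | succ s =>
      rw [List.take_succ_cons]
      exact h.imp (fun h => ⟨h.1, ih h.2 s⟩) (fun h => ⟨h.1, ih h.2 s⟩)

/-- A zero either equals the current entry of `Θ` or lies below it, so padding by zeros never leaves
the language. -/
lemma accepts_zeros (L : List ℕ) (r n : ℕ) : Accepts L r (List.replicate n 0) := by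
  induction n generalizing r with
  | zero => simp [Accepts]
  | succ n ih =>
    rw [List.replicate_succ]
    rcases (theta L r).eq_zero_or_pos with h | h
    · exact Or.inl ⟨h.symm, ih _⟩
    · exact Or.inr ⟨h, ih _⟩

lemma accepts_append_zeros {L : List ℕ} {r : ℕ} {ε : List ℕ} (h : Accepts L r ε) (n : ℕ) :
    Accepts L r (ε ++ List.replicate n 0) := by
  induction ε generalizing r with
  | nil => exact accepts_zeros L r n
  | cons c τ ih => exact h.imp (fun h => ⟨h.1, ih h.2⟩) (fun h => ⟨h.1, ih h.2⟩)

/-! ### The fundamental sequence -/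

/-- The fundamental sequence: its term at `t` is the number of words of length `t` in `𝓗°`. -/
def fundSeq (L : List ℕ) (t : ℕ) : ℕ :=
  1 + ∑ j : Fin t, theta L j * fundSeq L (t - 1 - j)
  decreasing_by omega

/-- The value of the largest word of length `t` accepted from the state `r`. -/
def maxVal (L : List ℕ) (r t : ℕ) : ℕ :=
  ∑ j ∈ Finset.range t, theta L (r + j) * fundSeq L (t - 1 - j)

lemma maxVal_succ (L : List ℕ) (r t : ℕ) :
    maxVal L r (t + 1) = theta L r * fundSeq L t + maxVal L (r + 1) t := by
  unfold maxVal
  rw [Finset.sum_range_succ', add_comm]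
  congr 1
  refine Finset.sum_congr rfl fun k _ => ?_
  congr 2 <;> omega

lemma fundSeq_eq (L : List ℕ) (t : ℕ) : fundSeq L t = maxVal L 0 t + 1 := by
  rw [fundSeq, maxVal, Finset.sum_range, add_comm]
  simp

lemma fundSeq_zero (L : List ℕ) : fundSeq L 0 = 1 := by rw [fundSeq_eq]; simp [maxVal]

lemma fundSeq_pos (L : List ℕ) (t : ℕ) : 0 < fundSeq L t := by
  rw [fundSeq_eq]; omega

/-- A digit below `Θ` loses at least one full term `H_t`, while the tail restarts from state `0` and
is worth at most `H_t - 1`. -/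
lemma conv_le_maxVal {L : List ℕ} {r : ℕ} {ε : List ℕ} (h : Accepts L r ε) :
    conv ε (fundSeq L) ≤ maxVal L r ε.length := by
  induction ε generalizing r with
  | nil => simp [conv_nil]
  | cons c τ ih =>
    rw [conv_cons, List.length_cons, maxVal_succ]
    rcases h with ⟨rfl, h⟩ | ⟨hc, h⟩
    · have := ih h; omega
    · have := ih h
      have h2 := fundSeq_eq L τ.length
      have h3 := Nat.mul_le_mul_right (fundSeq L τ.length) (Nat.succ_le_of_lt hc)
      rw [Nat.succ_mul] at h3
      omega

lemma conv_lt_fundSeq {L ε : List ℕ} (h : Accepts L 0 ε) :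
    conv ε (fundSeq L) < fundSeq L ε.length := by
  have := conv_le_maxVal h
  rw [fundSeq_eq]; omega

/-- Greedy algorithm: use the maximal digit if it fits; otherwise divide by `H_t`, the remainder
being within reach of state `0`. -/
lemma exists_accepts_conv_eq (L : List ℕ) (t r n : ℕ) (hn : n ≤ maxVal L r t) :
    ∃ ε : List ℕ, Accepts L r ε ∧ ε.length = t ∧ conv ε (fundSeq L) = n := by
  induction t generalizing r n with
  | zero => exact ⟨[], by simp [Accepts], rfl, by simp_all [maxVal, conv_nil]⟩
  | succ t ih =>
    rw [maxVal_succ] at hn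
    by_cases h : theta L r * fundSeq L t ≤ n
    · obtain ⟨τ, h1, h2, h3⟩ := ih (r + 1) (n - theta L r * fundSeq L t) (by omega)
      exact ⟨theta L r :: τ, Or.inl ⟨rfl, h1⟩, by simp [h2], by rw [conv_cons, h2, h3]; omega⟩
    · have hpos := fundSeq_pos L t
      have hlt := Nat.mod_lt n hpos
      obtain ⟨τ, h1, h2, h3⟩ := ih 0 (n % fundSeq L t) (by rw [fundSeq_eq] at hlt ⊢; omega)
      refine ⟨n / fundSeq L t :: τ, Or.inr ⟨?_, h1⟩, by simp [h2], ?_⟩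
      · exact (Nat.div_lt_iff_lt_mul hpos).2 (by omega)
      · rw [conv_cons, h2, h3, mul_comm]; exact Nat.div_add_mod _ _

/-! ### Lexicographic order and order by value -/

/-- The smaller digit is strictly below `Θ`, so its tail restarts from state `0` and cannot make up
one unit of the leading term. -/
lemma conv_cons_lt_of_lt {L : List ℕ} {r c c' : ℕ} {τ τ' : List ℕ} (h : Accepts L r (c :: τ))
    (h' : Accepts L r (c' :: τ')) (hlen : τ.length = τ'.length) (hc : c < c') :
    conv (c :: τ) (fundSeq L) < conv (c' :: τ') (fundSeq L) := by
  have hτ : Accepts L 0 τ := by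
    rcases h with h | h
    · rcases h' with h' | h' <;> omega
    · exact h.2
  have h1 := conv_lt_fundSeq hτ
  have h2 := Nat.mul_le_mul_right (fundSeq L τ.length) (Nat.succ_le_of_lt hc)
  rw [Nat.succ_mul] at h2
  rw [conv_cons, conv_cons, ← hlen]
  omega

lemma accepts_tails {L : List ℕ} {r c : ℕ} {τ τ' : List ℕ} (h : Accepts L r (c :: τ))
    (h' : Accepts L r (c :: τ')) : ∃ q, Accepts L q τ ∧ Accepts L q τ' := by
  rcases h with h | h <;> rcases h' with h' | h'
  · exact ⟨_, h.2, h'.2⟩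
  · omega
  · omega
  · exact ⟨_, h.2, h'.2⟩

/-- The first differing digit decides the comparison; truncation either keeps it or makes the two
prefixes equal. -/
lemma conv_take_le_conv_take {L : List ℕ} {r : ℕ} {ε ε' : List ℕ} (h : Accepts L r ε)
    (h' : Accepts L r ε') (hlen : ε.length = ε'.length)
    (hle : conv ε (fundSeq L) ≤ conv ε' (fundSeq L)) (s : ℕ) :
    conv (ε.take s) (fundSeq L) ≤ conv (ε'.take s) (fundSeq L) := by
  induction ε generalizing r ε' s with
  | nil => simp [conv_nil]
  | cons c τ ih =>
    cases s with
    | zero => simp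
    | succ s =>
      cases ε' with
      | nil => simp at hlen
      | cons c' τ' =>
        have hl : τ.length = τ'.length := by simpa using hlen
        rcases lt_trichotomy c c' with hc | rfl | hc
        · exact (conv_cons_lt_of_lt (accepts_take h (s + 1)) (accepts_take h' (s + 1))
            (by simp [hl]) hc).le
        · obtain ⟨q, hq, hq'⟩ := accepts_tails h h'
          rw [conv_cons, conv_cons, hl] at hle
          have := ih hq hq' hl (by omega) s
          rw [List.take_succ_cons, List.take_succ_cons, conv_cons, conv_cons]
          simp only [List.length_take, hl]
          omega
        · exact absurd (conv_cons_lt_of_lt h' h hl.symm hc) (by omega)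

lemma eq_of_conv_eq {L : List ℕ} {r : ℕ} {ε ε' : List ℕ} (h : Accepts L r ε)
    (h' : Accepts L r ε') (hlen : ε.length = ε'.length)
    (heq : conv ε (fundSeq L) = conv ε' (fundSeq L)) : ε = ε' := by
  induction ε generalizing r ε' with
  | nil => exact (List.length_eq_zero_iff.1 hlen.symm).symm
  | cons c τ ih =>
    cases ε' with
    | nil => simp at hlen
    | cons c' τ' =>
      have hl : τ.length = τ'.length := by simpa using hlen
      rcases lt_trichotomy c c' with hc | rfl | hc
      · exact absurd (conv_cons_lt_of_lt h h' hl hc) (by omega)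
      · obtain ⟨q, hq, hq'⟩ := accepts_tails h h'
        rw [conv_cons, conv_cons, hl] at heq
        rw [ih hq hq' hl (by omega)]
      · exact absurd (conv_cons_lt_of_lt h' h hl.symm hc) (by omega)

lemma theta_zero_pos {L : List ℕ} (hL : IsPrincipalMaximalBlock L) : 0 < theta L 0 := by simpa [theta] using hL.2

lemma fundSeq_strictMono {L : List ℕ} (hL : IsPrincipalMaximalBlock L) : StrictMono (fundSeq L) := by
  refine strictMono_nat_of_lt_succ fun t => ?_
  rw [fundSeq_eq L (t + 1), maxVal_succ]
  have := Nat.mul_le_mul_right (fundSeq L t) (theta_zero_pos hL)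
  omega

lemma conv_bounds {L : List ℕ} {ε : List ℕ} (h : ε ∈ collection L) :
    0 < ε.length ∧ fundSeq L (ε.length - 1) ≤ conv ε (fundSeq L) ∧
      conv ε (fundSeq L) < fundSeq L ε.length :=
  ⟨(le_conv_of_pos h.2 (fundSeq L)).1, (le_conv_of_pos h.2 _).2,
    conv_lt_fundSeq (memHcirc_iff.1 h.1)⟩

lemma pos_of_fundSeq_le_conv {L : List ℕ} (hL : IsPrincipalMaximalBlock L) {ε : List ℕ} {t : ℕ} (h : Accepts L 0 ε) (hlen : ε.length = t + 1)
    (hle : fundSeq L t ≤ conv ε (fundSeq L)) : 0 < ε.getD 0 0 := by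
  cases ε with
  | nil => simp at hlen
  | cons c τ =>
    rw [List.getD_cons_zero]
    by_contra hc
    obtain rfl : c = 0 := by omega
    have hτ : Accepts L 0 τ := by
      rcases h with h | h
      · have := theta_zero_pos hL; omega
      · exact h.2
    have h1 := conv_lt_fundSeq hτ
    have h2 : τ.length = t := by simpa using hlen
    rw [conv_cons, h2] at hle
    rw [h2] at h1
    omega

lemma exists_mem_collection {L : List ℕ} (hL : IsPrincipalMaximalBlock L) {n t : ℕ} (h1 : fundSeq L t ≤ n) (h2 : n < fundSeq L (t + 1)) :
    ∃ ε ∈ collection L, ε.length = t + 1 ∧ conv ε (fundSeq L) = n := by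
  obtain ⟨ε, ha, hl, hc⟩ := exists_accepts_conv_eq L (t + 1) 0 n (by
    rw [fundSeq_eq] at h2; omega)
  exact ⟨ε, ⟨memHcirc_iff.2 ha, pos_of_fundSeq_le_conv hL ha hl (by omega)⟩, hl, hc⟩

lemma length_eq_of_conv_eq {L : List ℕ} (hL : IsPrincipalMaximalBlock L) {ε ε' : List ℕ} (h : ε ∈ collection L) (h' : ε' ∈ collection L)
    (heq : conv ε (fundSeq L) = conv ε' (fundSeq L)) : ε.length = ε'.length := by
  have hm := fundSeq_strictMono hL
  obtain ⟨a1, a2, a3⟩ := conv_bounds h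
  obtain ⟨b1, b2, b3⟩ := conv_bounds h'
  have := hm.lt_iff_lt.1 (a2.trans_lt (heq ▸ b3))
  have := hm.lt_iff_lt.1 (b2.trans_lt (heq ▸ a3))
  omega

lemma isFundamentalSequence_fundSeq {L : List ℕ} (hL : IsPrincipalMaximalBlock L) : IsFundamentalSequence (collection L) (fundSeq L) := by
  have hm := fundSeq_strictMono hL
  refine ⟨hm, fundSeq_pos L, fun n hn => ?_⟩
  obtain ⟨t, h1, h2⟩ : ∃ t, fundSeq L t ≤ n ∧ n < fundSeq L (t + 1) := by
    have hex : ∃ t, n < fundSeq L t := ⟨n + 1, (hm.id_le (n + 1)).trans_lt' (Nat.lt_succ_self n)⟩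
    have hs := Nat.find_spec hex
    obtain ⟨t, ht⟩ : ∃ t, Nat.find hex = t + 1 := by
      refine Nat.exists_eq_succ_of_ne_zero fun h0 => ?_
      rw [h0, fundSeq_zero] at hs
      omega
    exact ⟨t, not_lt.1 (Nat.find_min hex (by omega)), ht ▸ hs⟩
  obtain ⟨ε, hε, -, hc⟩ := exists_mem_collection hL h1 h2
  refine ⟨ε, ⟨hε, hc⟩, fun ε' h' => ?_⟩
  exact eq_of_conv_eq (memHcirc_iff.1 h'.1.1) (memHcirc_iff.1 hε.1)
    (length_eq_of_conv_eq hL h'.1 hε (h'.2.trans hc.symm)) (h'.2.trans hc.symm)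

lemma one_zeros_mem_collection {L : List ℕ} (hL : IsPrincipalMaximalBlock L) (t : ℕ) : 1 :: List.replicate t 0 ∈ collection L := by
  refine ⟨memHcirc_iff.2 ?_, by simp⟩
  rcases (Nat.succ_le_of_lt (theta_zero_pos hL)).eq_or_lt with h | h
  · exact Or.inl ⟨h, accepts_zeros _ _ _⟩
  · exact Or.inr ⟨h, accepts_zeros _ _ _⟩

/-- Uniqueness allows every statement about an arbitrary fundamental sequence to be proved for
`fundSeq` alone. -/
lemma eq_fundSeq {L : List ℕ} (hL : IsPrincipalMaximalBlock L) {Q : ℕ → ℕ} (hQ : IsFundamentalSequence (collection L) Q) : Q = fundSeq L := by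
  have hm := fundSeq_strictMono hL
  funext t
  induction t using Nat.strong_induction_on with
  | _ t ih =>
  have hcongr : ∀ ε : List ℕ, ε.length ≤ t → conv ε Q = conv ε (fundSeq L) := fun ε h =>
    conv_congr fun k hk => ih k (by omega)
  apply le_antisymm
  · obtain ⟨ε, ⟨hε, hc⟩, -⟩ := hQ.2.2 _ (fundSeq_pos L t)
    -- A word this short has the same value under both sequences, hence a value below `fundSeq L t`;
    -- so the word is longer and its value is at least `Q t`.
    by_cases hl : ε.length ≤ t
    · have h1 := (conv_bounds hε).2.2
      rw [← hcongr ε hl, hc] at h1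
      have := hm.lt_iff_lt.1 h1
      omega
    · have h1 := (le_conv_of_pos hε.2 Q).2
      rw [hc] at h1
      exact (hQ.1.monotone (by omega)).trans h1
  · by_contra hlt
    rw [not_le] at hlt
    obtain ⟨ε, ⟨hε, hc⟩, -⟩ := (isFundamentalSequence_fundSeq hL).2.2 _ (hQ.2.1 t)
    obtain ⟨h1, h2, -⟩ := conv_bounds hε
    have h3 := hm.lt_iff_lt.1 (h2.trans_lt (hc ▸ hlt))
    have h4 : conv ε Q = Q t := by rw [hcongr ε (by omega), hc]
    -- If `Q t` were too small, the shorter word `ε` would be a second expansion of it besides `1,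
    -- 0, ..., 0`.
    have h5 : conv (1 :: List.replicate t 0) Q = Q t := by
      simp [conv_cons, conv_replicate_zero]
    have := (hQ.2.2 _ (hQ.2.1 t)).unique ⟨hε, h4⟩ ⟨one_zeros_mem_collection hL t, h5⟩
    have := congrArg List.length this
    simp at this
    omega

/-! ### Leading blocks as intervals -/

/-- Padding carries no information: a block may be traded for its first `s` entries, themselves a
word of the collection. For `s ≥ N` the padding is empty. -/
lemma blocks_spec {L : List ℕ} {s : ℕ} (hs : 1 ≤ s) {b : List ℕ} (hb : b ∈ blocks L (fundSeq L) s) :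
    b = b.take s ++ List.replicate (L.length - s) 0 ∧ (b.take s).length = s ∧
      b.take s ∈ collection L := by
  obtain ⟨⟨n, -, ε, hε, -, hlen, rfl⟩, hz⟩ := hb
  have hl : (ε.take (max s L.length)).length = max s L.length := by simp [hlen]
  refine ⟨?_, by simp; omega, ?_, ?_⟩
  · conv_lhs => rw [← List.take_append_drop s (ε.take (max s L.length))]
    congr 1
    refine List.eq_replicate_iff.2 ⟨by simp; omega, fun x hx => ?_⟩
    obtain ⟨i, hi, rfl⟩ := List.getElem_of_mem hx
    have h := hz (s + i) (by omega)
    rw [List.length_drop] at hi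
    rw [List.getD_eq_getElem _ _ (by omega)] at h
    simpa using h
  · exact memHcirc_iff.2 (accepts_take (accepts_take (memHcirc_iff.1 hε.1) _) _)
  · have := hε.2
    cases ε with
    | nil => simp at this
    | cons c τ =>
      obtain ⟨s, rfl⟩ := Nat.exists_eq_add_of_le' hs
      obtain ⟨m, hm⟩ := Nat.exists_eq_add_of_le' (hs.trans (le_max_left _ L.length))
      rw [hm]
      simpa using this

lemma append_zeros_mem_blocks {L : List ℕ} {β : List ℕ} (hβ : β ∈ collection L) :
    β ++ List.replicate (L.length - β.length) 0 ∈ blocks L (fundSeq L) β.length := by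
  obtain ⟨hpos, -⟩ := conv_bounds hβ
  have hmem : β ++ List.replicate (L.length - β.length) 0 ∈ collection L := by
    refine ⟨memHcirc_iff.2 (accepts_append_zeros (memHcirc_iff.1 hβ.1) _), ?_⟩
    rw [List.getD_append _ _ _ _ hpos]
    exact hβ.2
  obtain ⟨-, hle, -⟩ := conv_bounds hmem
  refine ⟨⟨_, (fundSeq_pos L _).trans_le hle, _, hmem, rfl, by simp; omega, ?_⟩, fun j hj => ?_⟩
  · rw [List.take_of_length_le (by simp; omega)]
  · rw [List.getD_append_right _ _ _ _ hj, List.getD_eq_getElem?_getD, List.getElem?_replicate]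
    split_ifs <;> rfl

/-- The successor value is still in `[H_{s-1}, H_s)`, where every number has an expansion of length
exactly `s`. -/
lemma tilde_of_lt {L : List ℕ} (hL : IsPrincipalMaximalBlock L) {s : ℕ} (hs : 1 ≤ s) {b : List ℕ}
    (hb : b ∈ blocks L (fundSeq L) s)
    (h : conv (b.take s) (fundSeq L) + 1 ≠ fundSeq L s) :
    tilde L (fundSeq L) s b ∈ blocks L (fundSeq L) s ∧
      1 + conv (b.take s) (fundSeq L) = conv ((tilde L (fundSeq L) s b).take s) (fundSeq L) := by
  obtain ⟨-, hlen, hβ⟩ := blocks_spec hs hb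
  obtain ⟨-, h2, h3⟩ := conv_bounds hβ
  rw [hlen] at h2 h3
  obtain ⟨γ, hγ, hl, hc⟩ := exists_mem_collection hL (t := s - 1)
    (n := conv (b.take s) (fundSeq L) + 1) (by omega) (by rw [Nat.sub_add_cancel hs]; omega)
  rw [Nat.sub_add_cancel hs] at hl
  have hex : ∃ c ∈ blocks L (fundSeq L) s,
      1 + conv (b.take s) (fundSeq L) = conv (c.take s) (fundSeq L) :=
    ⟨_, hl ▸ append_zeros_mem_blocks hγ, by rw [List.take_left' hl, hc, add_comm]⟩
  rw [tilde, dif_pos hex]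
  exact hex.choose_spec

lemma tilde_of_eq {L : List ℕ} {s : ℕ} (hs : 1 ≤ s) {b : List ℕ}
    (h : conv (b.take s) (fundSeq L) + 1 = fundSeq L s) :
    tilde L (fundSeq L) s b = exclusiveBlock L s := by
  rw [tilde, dif_neg]
  rintro ⟨c, hc, heq⟩
  obtain ⟨-, hlen, hβ⟩ := blocks_spec hs hc
  have := (conv_bounds hβ).2.2
  rw [hlen] at this
  omega

/-- The left end of the interval of numbers with `len β + j` digits and leading block `β`. -/
def blockStart (L β : List ℕ) (j : ℕ) : ℕ := conv (β ++ List.replicate j 0) (fundSeq L)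

/-- The right end of the interval of numbers with `s + j` digits and leading block `b`. -/
noncomputable def blockEnd (L : List ℕ) (s : ℕ) (b : List ℕ) (j : ℕ) : ℕ :=
  if conv (b.take s) (fundSeq L) + 1 = fundSeq L s then fundSeq L (s + j)
  else blockStart L ((tilde L (fundSeq L) s b).take s) j

lemma blockEnd_le {L : List ℕ} (hL : IsPrincipalMaximalBlock L) {s : ℕ} (hs : 1 ≤ s) {b : List ℕ}
    (hb : b ∈ blocks L (fundSeq L) s) (j : ℕ) : blockEnd L s b j ≤ fundSeq L (s + j) := by
  unfold blockEnd
  split_ifs with h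
  · exact le_rfl
  · obtain ⟨-, hl, hc⟩ := blocks_spec hs (tilde_of_lt hL hs hb h).1
    have := conv_lt_fundSeq (accepts_append_zeros (memHcirc_iff.1 hc.1) j)
    simp only [List.length_append, List.length_replicate, hl] at this
    exact this.le

lemma fundSeq_le_blockStart {L β : List ℕ} (hβ : β ∈ collection L) (j : ℕ) :
    fundSeq L (β.length + j - 1) ≤ blockStart L β j := by
  have hpos : 0 < (β ++ List.replicate j 0).getD 0 0 := by
    rw [List.getD_append _ _ _ _ (conv_bounds hβ).1]; exact hβ.2
  have := (le_conv_of_pos hpos (fundSeq L)).2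
  simpa [blockStart] using this

lemma conv_lt_blockEnd {L : List ℕ} (hL : IsPrincipalMaximalBlock L) {s : ℕ} (hs : 1 ≤ s)
    {b : List ℕ} (hb : b ∈ blocks L (fundSeq L) s) {ε : List ℕ} (hε : Accepts L 0 ε)
    (hsε : s ≤ ε.length) (htake : ε.take s = b.take s) :
    conv ε (fundSeq L) < blockEnd L s b (ε.length - s) := by
  unfold blockEnd
  split_ifs with h
  · rw [Nat.add_sub_cancel' hsε]
    exact conv_lt_fundSeq hε
  · obtain ⟨hc1, hc2⟩ := tilde_of_lt hL hs hb h
    obtain ⟨-, hl, hc⟩ := blocks_spec hs hc1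
    by_contra hlt
    have := conv_take_le_conv_take
      (accepts_append_zeros (memHcirc_iff.1 hc.1) (ε.length - s)) hε
      (by simp only [List.length_append, List.length_replicate, hl]; omega) (not_lt.1 hlt) s
    rw [List.take_left' hl, htake] at this
    omega

lemma conv_take_le_of_lt_blockEnd {L : List ℕ} (hL : IsPrincipalMaximalBlock L) {s : ℕ}
    (hs : 1 ≤ s) {b : List ℕ} (hb : b ∈ blocks L (fundSeq L) s) {ε : List ℕ}
    (hε : Accepts L 0 ε) (hsε : s ≤ ε.length)
    (hlt : conv ε (fundSeq L) < blockEnd L s b (ε.length - s)) :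
    conv (ε.take s) (fundSeq L) ≤ conv (b.take s) (fundSeq L) := by
  have hacc := accepts_take hε s
  have hlen : (ε.take s).length = s := by simp [hsε]
  unfold blockEnd at hlt
  split_ifs at hlt with h
  · have := conv_lt_fundSeq hacc
    rw [hlen] at this
    omega
  · obtain ⟨hc1, hc2⟩ := tilde_of_lt hL hs hb h
    obtain ⟨-, hl, hc⟩ := blocks_spec hs hc1
    have hle := conv_take_le_conv_take hε
      (accepts_append_zeros (memHcirc_iff.1 hc.1) (ε.length - s))
      (by simp only [List.length_append, List.length_replicate, hl]; omega) hlt.le s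
    rw [List.take_left' hl] at hle
    -- A prefix equal to the successor block would put `ε` at or beyond that block padded by zeros,
    -- the excluded right end.
    have hne : conv (ε.take s) (fundSeq L) ≠
        conv ((tilde L (fundSeq L) s b).take s) (fundSeq L) := fun heq => by
      have hz := conv_take_append_zeros_le ε s (fundSeq L)
      rw [eq_of_conv_eq hacc (memHcirc_iff.1 hc.1) (hlen.trans hl.symm) heq] at hz
      exact absurd hlt (not_lt.2 hz)
    omega

/-- By monotonicity of prefixes, the two inequalities squeeze the prefix value to that of `b|s`, and
equal values force equal words. The index `j` is the number of digits after the block. -/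
lemma lBEq_iff {L : List ℕ} (hL : IsPrincipalMaximalBlock L) {s : ℕ} (hs : 1 ≤ s) {b : List ℕ}
    (hb : b ∈ blocks L (fundSeq L) s) (n : ℕ) :
    LBEq L (fundSeq L) s n b ↔ ∃ j, blockStart L (b.take s) j ≤ n ∧ n < blockEnd L s b j := by
  obtain ⟨hbz, hlen, hβ⟩ := blocks_spec hs hb
  constructor
  · rintro ⟨c, ⟨ε, hε, rfl, hsε, rfl⟩, hbc⟩
    have htake : ε.take s = b.take s := by
      rw [hbc, List.take_left' (by simp [hsε])]
    refine ⟨ε.length - s, ?_, conv_lt_blockEnd hL hs hb (memHcirc_iff.1 hε.1) hsε htake⟩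
    rw [← htake]
    exact conv_take_append_zeros_le ε s (fundSeq L)
  · rintro ⟨j, h1, h2⟩
    have hlow := (fundSeq_le_blockStart hβ j).trans h1
    rw [hlen] at hlow
    have hsj : s + j - 1 + 1 = s + j := by omega
    obtain ⟨ε, hε, hεl, rfl⟩ := exists_mem_collection hL hlow
      (by rw [hsj]; exact h2.trans_le (blockEnd_le hL hs hb j))
    rw [hsj] at hεl
    have hεacc := memHcirc_iff.1 hε.1
    have hge := conv_take_le_conv_take (accepts_append_zeros (memHcirc_iff.1 hβ.1) j) hεacc
      (by simp only [List.length_append, List.length_replicate, hlen]; omega) h1 s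
    rw [List.take_left' hlen] at hge
    have hle := conv_take_le_of_lt_blockEnd hL hs hb hεacc (by omega)
      (by rwa [hεl, Nat.add_sub_cancel_left])
    refine ⟨ε.take s, ⟨ε, hε, rfl, by omega, rfl⟩, ?_⟩
    rw [← eq_of_conv_eq (memHcirc_iff.1 hβ.1) (accepts_take hεacc s)
      (hlen.trans (by simp [hεl])) (le_antisymm hge hle)]
    exact hbz

/-! ### The dominant zero and the growth of the fundamental sequence -/

/-- The coefficients `(a_1, ..., a_{N-1}, 1 + a_N)` of the recursion of the fundamental sequence. -/
def recCoeff (L : List ℕ) (j : ℕ) : ℕ := L.getD j 0 + if j + 1 = L.length then 1 else 0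

lemma theta_of_lt {L : List ℕ} {j : ℕ} (h : j < L.length) : theta L j = L.getD j 0 := by
  rw [theta, Nat.mod_eq_of_lt h]

lemma theta_length_add (L : List ℕ) (j : ℕ) : theta L (L.length + j) = theta L j := by
  simp [theta]

lemma sum_recCoeff_mul {R : Type*} [CommSemiring R] {L : List ℕ} (hN : 0 < L.length) (f : ℕ → R) :
    ∑ j ∈ Finset.range L.length, (recCoeff L j : R) * f j =
      ∑ j ∈ Finset.range L.length, (L.getD j 0 : R) * f j + f (L.length - 1) := by
  have h : ∀ j ∈ Finset.range L.length, (recCoeff L j : R) * f j =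
      (L.getD j 0 : R) * f j + if j = L.length - 1 then f j else 0 := by
    intro j _
    rw [recCoeff]
    by_cases hj : j + 1 = L.length
    · rw [if_pos hj, if_pos (by omega)]; push_cast; ring
    · rw [if_neg hj, if_neg (by omega)]; simp
  rw [Finset.sum_congr rfl h, Finset.sum_add_distrib, Finset.sum_ite_eq',
    if_pos (Finset.mem_range.2 (by omega))]

/-- Cut the maximal word after one period of `Θ`: the rest, together with the constant `1`, is worth
`H_t`. This is the source of the extra one in the last coefficient. -/
lemma fundSeq_rec {L : List ℕ} (hN : 0 < L.length) (t : ℕ) :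
    fundSeq L (t + L.length) =
      ∑ j ∈ Finset.range L.length, recCoeff L j * fundSeq L (t + (L.length - 1 - j)) := by
  have key := sum_recCoeff_mul hN (fun j => fundSeq L (t + (L.length - 1 - j)))
  simp only [Nat.cast_id] at key
  rw [key, fundSeq_eq, maxVal, add_comm t, Finset.sum_range_add, add_assoc]
  congr 1
  · refine Finset.sum_congr rfl fun j hj => ?_
    rw [Finset.mem_range] at hj
    rw [zero_add, theta_of_lt hj]
    congr 2
    omega
  · rw [Nat.sub_self, add_zero, fundSeq_eq, maxVal]
    congr 1
    refine Finset.sum_congr rfl fun j hj => ?_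
    rw [zero_add, zero_add, theta_length_add]
    congr 2
    omega

lemma aeval_charPoly {R : Type*} [CommRing R] {L : List ℕ} (hN : 0 < L.length) (z : R) :
    Polynomial.aeval z (charPoly L) =
      z ^ L.length - ∑ j ∈ Finset.range L.length, (recCoeff L j : R) * z ^ (L.length - 1 - j) := by
  obtain ⟨N, hN'⟩ : ∃ N, L.length = N + 1 := ⟨L.length - 1, by omega⟩
  rw [sum_recCoeff_mul hN, charPoly, hN', Finset.sum_range_succ]
  simp
  ring

lemma isIntegral_of_aeval_charPoly_eq_zero {L : List ℕ} (hN : 0 < L.length) {z : ℝ}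
    (hz : Polynomial.aeval z (charPoly L) = 0) : IsIntegral ℤ z := by
  refine ⟨charPoly L, ?_, by rwa [← Polynomial.aeval_def]⟩
  rw [charPoly, sub_sub]
  refine Polynomial.monic_X_pow_sub ((Polynomial.degree_add_le _ _).trans_lt (max_lt ?_ ?_))
  · refine (Polynomial.degree_sum_le _ _).trans_lt ((Finset.sup_lt_iff ?_).2 fun j hj => ?_)
    · exact WithBot.bot_lt_coe _
    · refine (Polynomial.degree_C_mul_X_pow_le _ _).trans_lt ?_
      exact_mod_cast (by omega : L.length - 1 - j < L.length)
  · exact Polynomial.degree_C_le.trans_lt (by exact_mod_cast hN)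

/-- The weights `c_j ψ^{-(j+1)}`. -/
noncomputable def weight (L : List ℕ) (ψ : ℝ) (j : ℕ) : ℝ := recCoeff L j * ψ⁻¹ ^ (j + 1)

lemma aeval_charPoly_eq_zero_iff {K : Type*} [Field K] {L : List ℕ} (hN : 0 < L.length) {z : K}
    (hz : z ≠ 0) : Polynomial.aeval z (charPoly L) = 0 ↔
      ∑ j ∈ Finset.range L.length, (recCoeff L j : K) * z⁻¹ ^ (j + 1) = 1 := by
  have h : ∑ j ∈ Finset.range L.length, (recCoeff L j : K) * z ^ (L.length - 1 - j) =
      z ^ L.length * ∑ j ∈ Finset.range L.length, (recCoeff L j : K) * z⁻¹ ^ (j + 1) := by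
    rw [Finset.mul_sum]
    refine Finset.sum_congr rfl fun j hj => ?_
    rw [Finset.mem_range] at hj
    have : z ^ L.length = z ^ (L.length - 1 - j) * z ^ (j + 1) := by
      rw [← pow_add]; congr 1; omega
    rw [this, inv_pow]
    field_simp
  have hz' := pow_ne_zero L.length hz
  rw [aeval_charPoly hN, h, sub_eq_zero]
  constructor
  · intro h
    exact (mul_left_cancel₀ hz' (by rw [← h, mul_one]))
  · intro h
    rw [h, mul_one]

lemma recCoeff_zero_pos {L : List ℕ} (hL : IsPrincipalMaximalBlock L) : 1 ≤ recCoeff L 0 := by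
  have := hL.2
  unfold recCoeff
  omega

lemma two_le_sum_recCoeff {L : List ℕ} (hL : IsPrincipalMaximalBlock L) :
    2 ≤ ∑ j ∈ Finset.range L.length, recCoeff L j := by
  have hN := hL.1
  have key := sum_recCoeff_mul (R := ℕ) (L := L) (by omega) (fun _ => 1)
  simp only [Nat.cast_id, mul_one] at key
  rw [key]
  have := Finset.single_le_sum (f := fun j => L.getD j 0) (fun _ _ => Nat.zero_le _)
    (Finset.mem_range.2 (show 0 < L.length by omega))
  have := hL.2
  lia

/-- Intermediate values between `1` and the sum `C` of the recursion coefficients; `C ≥ 2` makes the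
polynomial negative at `1`. -/
lemma exists_zero_gt_one {L : List ℕ} (hL : IsPrincipalMaximalBlock L) :
    ∃ ψ : ℝ, 1 < ψ ∧ Polynomial.aeval ψ (charPoly L) = 0 := by
  have hN : 0 < L.length := by have := hL.1; omega
  set C : ℝ := ∑ j ∈ Finset.range L.length, (recCoeff L j : ℝ) with hC
  have hC2 : 2 ≤ C := by
    rw [hC]
    exact_mod_cast two_le_sum_recCoeff hL
  have hcont : Continuous fun x : ℝ => Polynomial.aeval x (charPoly L) :=
    (charPoly L).continuous_aeval
  have h1 : Polynomial.aeval (1 : ℝ) (charPoly L) < 0 := by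
    rw [aeval_charPoly hN]; simp only [one_pow, mul_one]; linarith
  have hB : 0 ≤ Polynomial.aeval (C : ℝ) (charPoly L) := by
    rw [aeval_charPoly hN, sub_nonneg]
    calc ∑ j ∈ Finset.range L.length, (recCoeff L j : ℝ) * C ^ (L.length - 1 - j)
        ≤ ∑ j ∈ Finset.range L.length, (recCoeff L j : ℝ) * C ^ (L.length - 1) := by
          refine Finset.sum_le_sum fun j _ => mul_le_mul_of_nonneg_left ?_ (Nat.cast_nonneg _)
          exact pow_le_pow_right₀ (by linarith) (by omega)
      _ = C ^ L.length := by
          rw [← Finset.sum_mul, ← hC, ← pow_succ', Nat.sub_add_cancel hN]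
  obtain ⟨ψ, hψ, h0⟩ := intermediate_value_Icc (by linarith : (1 : ℝ) ≤ C) hcont.continuousOn
    ⟨h1.le, hB⟩
  refine ⟨ψ, lt_of_le_of_ne hψ.1 ?_, h0⟩
  rintro rfl
  simp only at h0
  linarith

lemma weight_nonneg {L : List ℕ} {ψ : ℝ} (hψ : 1 < ψ) (j : ℕ) : 0 ≤ weight L ψ j := by
  unfold weight; positivity

lemma sum_weight {L : List ℕ} (hL : IsPrincipalMaximalBlock L) {ψ : ℝ} (hψ : 1 < ψ)
    (h0 : Polynomial.aeval ψ (charPoly L) = 0) :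
    ∑ j ∈ Finset.range L.length, weight L ψ j = 1 :=
  (aeval_charPoly_eq_zero_iff (by have := hL.1; omega) (by linarith)).1 h0

lemma weight_zero_pos {L : List ℕ} (hL : IsPrincipalMaximalBlock L) {ψ : ℝ} (hψ : 1 < ψ) :
    0 < weight L ψ 0 := by
  have h : (0 : ℝ) < recCoeff L 0 := by exact_mod_cast recCoeff_zero_pos hL
  unfold weight; positivity

/-- For a zero `z` with `|z| ≥ ψ` put `w = ψ / z`. A convex combination of the powers `w^(j+1)`, all
in the closed unit disc, equals the extreme point `1`; as `w` itself has positive weight, `w = 1`.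
-/
lemma isDominantRealZero_of_one_lt {L : List ℕ} (hL : IsPrincipalMaximalBlock L) {ψ : ℝ}
    (hψ : 1 < ψ) (h0 : Polynomial.aeval ψ (charPoly L) = 0) : IsDominantRealZero L ψ := by
  have hN : 0 < L.length := by have := hL.1; omega
  refine ⟨h0, fun z hz hne => ?_⟩
  rw [abs_of_pos (by linarith)]
  by_contra hle
  rw [not_lt] at hle
  have hz0 : z ≠ 0 := by rintro rfl; simp at hle; linarith
  set w : ℂ := ψ * z⁻¹ with hw
  have hw1 : ‖w‖ ≤ 1 := by
    rw [hw, norm_mul, norm_inv, Complex.norm_real, Real.norm_of_nonneg (by linarith)]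
    exact mul_inv_le_one_of_le₀ hle (norm_nonneg _)
  have hsum : ∑ j ∈ Finset.range L.length, weight L ψ j * (w ^ (j + 1)).re = 1 := by
    have h := (aeval_charPoly_eq_zero_iff hN hz0).1 hz
    have h2 := congrArg Complex.re h
    rw [Complex.re_sum, Complex.one_re] at h2
    rw [← h2]
    refine Finset.sum_congr rfl fun j _ => ?_
    rw [← Complex.re_ofReal_mul]
    congr 1
    have hψ0 : (ψ : ℂ) ≠ 0 := by exact_mod_cast (by linarith : ψ ≠ 0)
    rw [hw, weight]
    push_cast
    rw [mul_assoc, ← mul_pow, inv_mul_cancel_left₀ hψ0]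
  have hre : ∀ j, (w ^ (j + 1)).re ≤ 1 := fun j =>
    (Complex.re_le_norm _).trans (by rw [norm_pow]; exact pow_le_one₀ (norm_nonneg _) hw1)
  have hz : ∑ j ∈ Finset.range L.length, weight L ψ j * (1 - (w ^ (j + 1)).re) = 0 := by
    simp only [mul_sub, mul_one, Finset.sum_sub_distrib, hsum, sum_weight hL hψ h0, sub_self]
  have h1 := (Finset.sum_eq_zero_iff_of_nonneg fun j _ =>
    mul_nonneg (weight_nonneg hψ j) (sub_nonneg.2 (hre j))).1 hz 0 (Finset.mem_range.2 hN)
  have hre1 : w.re = 1 := by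
    rcases mul_eq_zero.1 h1 with h | h
    · exact absurd h (weight_zero_pos hL hψ).ne'
    · simp at h; linarith
  have him : w.im = 0 := by
    have h3 := Complex.sq_norm w
    rw [Complex.normSq_apply, hre1] at h3
    nlinarith [norm_nonneg w, sq_nonneg w.im]
  have hw' : w = 1 := Complex.ext (by simp [hre1]) (by simp [him])
  apply hne
  rw [hw] at hw'
  field_simp at hw'
  exact hw'.symm

/-- Two different dominant zeros would each exceed the other in absolute value, so `ψ` is the zero
above `1` already found. -/
lemma one_lt_of_isDominantRealZero {L : List ℕ} (hL : IsPrincipalMaximalBlock L) {ψ : ℝ}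
    (h : IsDominantRealZero L ψ) : 1 < ψ := by
  obtain ⟨φ, hφ, h0⟩ := exists_zero_gt_one hL
  have hd := isDominantRealZero_of_one_lt hL hφ h0
  have hc : ∀ {x : ℝ}, Polynomial.aeval x (charPoly L) = 0 →
      Polynomial.aeval (x : ℂ) (charPoly L) = 0 := fun {x} hx => by
    have := Polynomial.aeval_algebraMap_apply ℂ x (charPoly L)
    rw [hx, map_zero] at this
    exact this
  by_contra hle
  have hne : (ψ : ℂ) ≠ φ := by
    intro heq
    rw [Complex.ofReal_inj] at heq
    exact hle (heq ▸ hφ)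
  have h1 := hd.2 ψ (hc h.1) hne
  have h2 := h.2 φ (hc h0) hne.symm
  rw [Complex.norm_real, Real.norm_eq_abs] at h1 h2
  exact lt_asymm h1 h2

/-- Bounds on a window of length `N` propagate along a recursion by weighted averages. -/
lemma le_of_window_le {N : ℕ} {p u : ℕ → ℝ} (hp : ∀ j, 0 ≤ p j)
    (hsum : ∑ j ∈ Finset.range N, p j = 1)
    (hu : ∀ t, u (t + N) = ∑ j ∈ Finset.range N, p j * u (t + (N - 1 - j))) {b : ℝ} {t₀ : ℕ}
    (hb : ∀ i < N, u (t₀ + i) ≤ b) (i : ℕ) : u (t₀ + i) ≤ b := by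
  induction i using Nat.strong_induction_on with
  | _ i ih =>
  by_cases hi : i < N
  · exact hb i hi
  · obtain ⟨k, rfl⟩ := Nat.exists_eq_add_of_le' (not_lt.1 hi)
    rw [← add_assoc, hu]
    calc _ ≤ ∑ j ∈ Finset.range N, p j * b := by
          refine Finset.sum_le_sum fun j hj => mul_le_mul_of_nonneg_left ?_ (hp j)
          rw [Finset.mem_range] at hj
          rw [add_assoc]
          exact ih _ (by omega)
      _ = b := by rw [← Finset.sum_mul, hsum, one_mul]

/-- A deficit `d` at one term survives in the next with factor at least `p 0`, since the other terms
averaged are at most `b`. Within `N` further steps it has reached a whole window, which then bounds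
everything later. -/
lemma contract_above {N : ℕ} (hN : 0 < N) {p u : ℕ → ℝ} (hp : ∀ j, 0 ≤ p j)
    (hsum : ∑ j ∈ Finset.range N, p j = 1)
    (hu : ∀ t, u (t + N) = ∑ j ∈ Finset.range N, p j * u (t + (N - 1 - j))) {b d : ℝ} (hd : 0 ≤ d)
    {t₀ : ℕ} (hb : ∀ i, u (t₀ + i) ≤ b) (hmid : u (t₀ + (N - 1)) ≤ b - d) (i : ℕ) :
    u (t₀ + N + i) ≤ b - p 0 ^ N * d := by
  have hp1 : p 0 ≤ 1 := by
    rw [← hsum]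
    exact Finset.single_le_sum (fun j _ => hp j) (Finset.mem_range.2 hN)
  have hstep : ∀ k, u (t₀ + (N - 1) + k) ≤ b - p 0 ^ k * d := by
    intro k
    induction k with
    | zero => simpa using hmid
    | succ k ih =>
      have he : t₀ + (N - 1) + (k + 1) = t₀ + k + N := by omega
      have h0 : (0 : ℕ) ∈ Finset.range N := Finset.mem_range.2 hN
      rw [he, hu, ← Finset.add_sum_erase _ _ h0]
      have h1 : p 0 * u (t₀ + k + (N - 1 - 0)) ≤ p 0 * (b - p 0 ^ k * d) := by
        refine mul_le_mul_of_nonneg_left ?_ (hp 0)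
        have : t₀ + k + (N - 1 - 0) = t₀ + (N - 1) + k := by omega
        rw [this]; exact ih
      have h2 : ∑ j ∈ (Finset.range N).erase 0, p j * u (t₀ + k + (N - 1 - j)) ≤
          ∑ j ∈ (Finset.range N).erase 0, p j * b :=
        Finset.sum_le_sum fun j _ => mul_le_mul_of_nonneg_left
          (by rw [add_assoc]; exact hb _) (hp j)
      have h3 := Finset.add_sum_erase _ p h0
      rw [hsum] at h3
      rw [← Finset.sum_mul] at h2
      calc _ ≤ p 0 * (b - p 0 ^ k * d) + (∑ j ∈ (Finset.range N).erase 0, p j) * b := add_le_add h1 h2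
        _ = (p 0 + ∑ j ∈ (Finset.range N).erase 0, p j) * b - p 0 ^ (k + 1) * d := by ring
        _ = _ := by rw [h3, one_mul]
  refine le_of_window_le hp hsum hu (t₀ := t₀ + N) (fun i hi => ?_) i
  have he : t₀ + N + i = t₀ + (N - 1) + (i + 1) := by omega
  rw [he]
  refine (hstep (i + 1)).trans ?_
  have := mul_le_mul_of_nonneg_right (pow_le_pow_of_le_one (hp 0) hp1 (by omega : i + 1 ≤ N)) hd
  linarith

lemma exists_contraction {N : ℕ} (hN : 0 < N) {p u : ℕ → ℝ} (hp : ∀ j, 0 ≤ p j)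
    (hsum : ∑ j ∈ Finset.range N, p j = 1)
    (hu : ∀ t, u (t + N) = ∑ j ∈ Finset.range N, p j * u (t + (N - 1 - j))) {a b : ℝ} {t₀ : ℕ}
    (h : ∀ i, a ≤ u (t₀ + i) ∧ u (t₀ + i) ≤ b) :
    ∃ a' b' : ℝ, b' - a' = (1 - p 0 ^ N / 2) * (b - a) ∧
      ∀ i, a' ≤ u (t₀ + N + i) ∧ u (t₀ + N + i) ≤ b' := by
  have hab : 0 ≤ (b - a) / 2 := by linarith [(h 0).1.trans (h 0).2]
  -- One window term lies in the lower or upper half of `[a, b]`; the opposite bound improves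
  -- accordingly, the upper case by passing to `-u`.
  rcases le_total (u (t₀ + (N - 1))) ((a + b) / 2) with hm | hm
  · refine ⟨a, b - p 0 ^ N * ((b - a) / 2), by ring, fun i => ⟨?_, ?_⟩⟩
    · rw [add_assoc]; exact (h _).1
    · exact contract_above hN hp hsum hu hab (fun i => (h i).2) (by linarith) i
  · refine ⟨a + p 0 ^ N * ((b - a) / 2), b, by ring, fun i => ⟨?_, ?_⟩⟩
    · have := contract_above (u := fun t => -u t) (b := -a) hN hp hsum (fun t => by
        simp only [hu t, mul_neg, Finset.sum_neg_distrib]) hab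
        (fun i => neg_le_neg (h i).1) (by linarith) i
      linarith
    · rw [add_assoc]; exact (h _).2

/-- A sequence satisfying a recursion by weighted averages converges. -/
lemma exists_tendsto_of_average_rec {N : ℕ} (hN : 0 < N) {p u : ℕ → ℝ} (hp : ∀ j, 0 ≤ p j)
    (hp0 : 0 < p 0) (hsum : ∑ j ∈ Finset.range N, p j = 1)
    (hu : ∀ t, u (t + N) = ∑ j ∈ Finset.range N, p j * u (t + (N - 1 - j)))
    (hpos : ∀ t, 0 < u t) : ∃ α : ℝ, 0 < α ∧ Tendsto u atTop (𝓝 α) := by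
  have hp1 : p 0 ≤ 1 := by
    rw [← hsum]
    exact Finset.single_le_sum (fun j _ => hp j) (Finset.mem_range.2 hN)
  obtain ⟨B, hB⟩ : ∃ B, ∀ i, u (0 + i) ≤ B := by
    obtain ⟨B, hB⟩ := ((Finset.range N).image u).bddAbove
    exact ⟨B, le_of_window_le hp hsum hu fun i hi => by
      rw [zero_add]
      exact hB (Finset.mem_coe.2 (Finset.mem_image_of_mem u (Finset.mem_range.2 hi)))⟩
  -- The minimum over the first window persists as a lower bound and keeps the limit positive.
  obtain ⟨A, hA0, hA⟩ : ∃ A, 0 < A ∧ ∀ i, A ≤ u (0 + i) := by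
    obtain ⟨k, -, hk⟩ := (Finset.range N).exists_min_image u ⟨0, Finset.mem_range.2 hN⟩
    refine ⟨u k, hpos k, fun i => ?_⟩
    have := le_of_window_le (u := fun t => -u t) (b := -u k) (t₀ := 0) hp hsum (fun t => by
        simp only [hu t, mul_neg, Finset.sum_neg_distrib]) (fun i hi => by
          rw [zero_add]
          exact neg_le_neg (hk i (Finset.mem_range.2 hi))) i
    linarith
  set q : ℝ := 1 - p 0 ^ N / 2 with hq
  have hpN : 0 < p 0 ^ N := pow_pos hp0 N
  have hpN1 : p 0 ^ N ≤ 1 := pow_le_one₀ hp0.le hp1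
  have hwin : ∀ k : ℕ, ∃ a b : ℝ, b - a = q ^ k * (B - A) ∧
      ∀ i, a ≤ u (k * N + i) ∧ u (k * N + i) ≤ b := by
    intro k
    induction k with
    | zero => exact ⟨A, B, by simp, fun i => by rw [zero_mul]; exact ⟨hA i, hB i⟩⟩
    | succ k ih =>
      obtain ⟨a, b, hab, h⟩ := ih
      obtain ⟨a', b', hab', h'⟩ := exists_contraction hN hp hsum hu h
      refine ⟨a', b', by rw [hab', hab, pow_succ]; ring, ?_⟩
      rw [Nat.succ_mul]
      exact h'
  have hcauchy : CauchySeq u := by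
    refine Metric.cauchySeq_iff'.2 fun ε hε => ?_
    have hlim : Tendsto (fun k => q ^ k * (B - A)) atTop (𝓝 0) := by
      have := (tendsto_pow_atTop_nhds_zero_of_lt_one (r := q) (by linarith) (by linarith)).mul_const
        (B - A)
      rwa [zero_mul] at this
    obtain ⟨k, hk⟩ := (hlim.eventually (gt_mem_nhds hε)).exists
    obtain ⟨a, b, hab, h⟩ := hwin k
    refine ⟨k * N, fun n hn => ?_⟩
    obtain ⟨i, rfl⟩ := Nat.exists_eq_add_of_le hn
    have h1 := h i
    have h2 := h 0
    rw [add_zero] at h2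
    rw [Real.dist_eq, abs_lt]
    constructor <;> linarith [h1.1, h1.2, h2.1, h2.2]
  obtain ⟨α, hα⟩ := cauchySeq_tendsto_of_complete hcauchy
  refine ⟨α, hA0.trans_le (ge_of_tendsto' hα fun i => ?_), hα⟩
  simpa using hA i

lemma exists_tendsto_fundSeq_div {L : List ℕ} (hL : IsPrincipalMaximalBlock L) {ψ : ℝ}
    (hψ : 1 < ψ) (h0 : Polynomial.aeval ψ (charPoly L) = 0) :
    ∃ α : ℝ, 0 < α ∧ Tendsto (fun t => (fundSeq L t : ℝ) / ψ ^ t) atTop (𝓝 α) := by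
  have hN : 0 < L.length := by have := hL.1; omega
  have hψ0 : 0 < ψ := by linarith
  refine exists_tendsto_of_average_rec hN (weight_nonneg hψ) (weight_zero_pos hL hψ)
    (sum_weight hL hψ h0) (fun t => ?_) fun t => ?_
  · rw [fundSeq_rec hN]
    push_cast
    rw [Finset.sum_div]
    refine Finset.sum_congr rfl fun j hj => ?_
    rw [Finset.mem_range] at hj
    have : ψ ^ (t + L.length) = ψ ^ (t + (L.length - 1 - j)) * ψ ^ (j + 1) := by
      rw [← pow_add]; congr 1; omega
    rw [weight, this, inv_pow]
    field_simp
  · have : (0 : ℝ) < fundSeq L t := by exact_mod_cast fundSeq_pos L t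
    positivity

open MeasureTheory

/-! ### Equidistribution of the multiples of an irrational number -/

/-- The average of `f` over the points `θ, 2θ, ..., Mθ` of the circle. -/
noncomputable def rotAvg (θ : ℝ) (M : ℕ) (f : UnitAddCircle → ℂ) : ℂ :=
  (M : ℂ)⁻¹ * ∑ n ∈ Finset.range M, f (((n + 1 : ℕ) * θ : ℝ) : UnitAddCircle)

lemma norm_rotAvg_sub_le {θ : ℝ} (M : ℕ) {f g : UnitAddCircle → ℂ} {ε : ℝ} (hε : 0 ≤ ε)
    (h : ∀ x, ‖f x - g x‖ ≤ ε) : ‖rotAvg θ M f - rotAvg θ M g‖ ≤ ε := by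
  rw [rotAvg, rotAvg, ← mul_sub, ← Finset.sum_sub_distrib, norm_mul, norm_inv, Complex.norm_natCast]
  rcases M.eq_zero_or_pos with rfl | hM
  · simpa using hε
  · have hM' : (0 : ℝ) < M := by exact_mod_cast hM
    rw [inv_mul_le_iff₀ hM']
    refine (norm_sum_le_of_le _ fun n _ => h _).trans ?_
    simp

/-- For `k ≠ 0` the sum is geometric with ratio `z = exp(2πikθ) ≠ 1`, by irrationality, hence
bounded by `2 / ‖z - 1‖` independently of `M`. -/
lemma tendsto_rotAvg_fourier {θ : ℝ} (hθ : Irrational θ) (k : ℤ) :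
    Tendsto (fun M => rotAvg θ M (fourier k)) atTop
      (𝓝 (∫ x : UnitAddCircle, (fourier k x : ℂ))) := by
  by_cases hk : k = 0
  · subst hk
    have h1 : ∫ x : UnitAddCircle, (fourier 0 x : ℂ) = 1 := by
      simp [measureReal_def]
    rw [h1]
    refine tendsto_const_nhds.congr' ?_
    filter_upwards [eventually_gt_atTop 0] with M hM
    have hM' : (M : ℂ) ≠ 0 := by exact_mod_cast hM.ne'
    simp [rotAvg, hM']
  · have h0 : ∫ x : UnitAddCircle, (fourier k x : ℂ) = 0 :=
      integral_eq_zero_of_add_right_eq_neg (fourier_add_half_inv_index hk one_pos)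
    rw [h0]
    set z : ℂ := Complex.exp (2 * Real.pi * Complex.I * (k * θ)) with hz
    have hz1 : z ≠ 1 := by
      intro h
      rw [hz, Complex.exp_eq_one_iff] at h
      obtain ⟨m, hm⟩ := h
      have hpi : (2 * Real.pi * Complex.I : ℂ) ≠ 0 := Complex.two_pi_I_ne_zero
      have h2 : ((k * θ : ℝ) : ℂ) = ((m : ℝ) : ℂ) := by
        push_cast
        exact mul_left_cancel₀ hpi (by rw [hm]; ring)
      exact (hθ.intCast_mul hk).ne_int m (Complex.ofReal_injective h2)
    have hnz : ‖z‖ = 1 := by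
      rw [hz, show (2 * Real.pi * Complex.I * (k * θ) : ℂ) =
        ((2 * Real.pi * (k * θ) : ℝ) : ℂ) * Complex.I by push_cast; ring]
      exact Complex.norm_exp_ofReal_mul_I _
    have hterm : ∀ n : ℕ, (fourier k (((n + 1 : ℕ) * θ : ℝ) : UnitAddCircle) : ℂ) = z * z ^ n := by
      intro n
      rw [fourier_coe_apply, ← pow_succ', hz, ← Complex.exp_nat_mul]
      congr 1
      push_cast
      ring
    refine squeeze_zero_norm (a := fun M : ℕ => (M : ℝ)⁻¹ * (2 / ‖z - 1‖)) (fun M => ?_) ?_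
    · simp only [rotAvg, hterm]
      rw [← Finset.mul_sum, geom_sum_eq hz1, norm_mul, norm_mul, hnz, one_mul, norm_inv,
        Complex.norm_natCast, norm_div]
      gcongr
      refine (norm_sub_le _ _).trans ?_
      rw [norm_pow, hnz]
      norm_num
    · have := (tendsto_inv_atTop_nhds_zero_nat (𝕜 := ℝ)).mul_const (2 / ‖z - 1‖)
      rwa [zero_mul] at this

/-- Trigonometric polynomials are uniformly dense, and both the averages and the integral are
contractions for the sup norm. -/
lemma tendsto_rotAvg {θ : ℝ} (hθ : Irrational θ) (f : C(UnitAddCircle, ℂ)) :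
    Tendsto (fun M => rotAvg θ M f) atTop (𝓝 (∫ x, f x)) := by
  have hint : ∀ g : C(UnitAddCircle, ℂ), Integrable g := fun g =>
    g.continuous.integrable_of_hasCompactSupport (HasCompactSupport.of_compactSpace _)
  have hspan : ∀ g ∈ Submodule.span ℂ (Set.range (fourier (T := 1))),
      Tendsto (fun M => rotAvg θ M g) atTop (𝓝 (∫ x, g x)) := by
    intro g hg
    induction hg using Submodule.span_induction with
    | mem g hg =>
      obtain ⟨k, rfl⟩ := hg
      exact tendsto_rotAvg_fourier hθ k
    | zero => simp [rotAvg]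
    | add g h _ _ ihg ihh =>
      simp only [ContinuousMap.add_apply]
      rw [integral_add (hint g) (hint h)]
      refine (ihg.add ihh).congr fun M => ?_
      simp only [rotAvg, ContinuousMap.add_apply, Finset.sum_add_distrib, mul_add]
    | smul c g _ ihg =>
      simp only [ContinuousMap.smul_apply]
      rw [integral_smul]
      refine (ihg.const_smul c).congr fun M => ?_
      simp only [rotAvg, ContinuousMap.smul_apply, smul_eq_mul, ← Finset.mul_sum]
      ring
  rw [Metric.tendsto_atTop]
  intro ε hε
  have hf : f ∈ closure (Submodule.span ℂ (Set.range (fourier (T := 1))) : Set C(UnitAddCircle, ℂ)) := by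
    rw [← Submodule.topologicalClosure_coe, span_fourier_closure_eq_top]
    trivial
  obtain ⟨g, hg, hfg⟩ := Metric.mem_closure_iff.1 hf (ε / 3) (by positivity)
  rw [dist_eq_norm] at hfg
  have hle : ∀ x, ‖f x - g x‖ ≤ ε / 3 := fun x =>
    ((f - g).norm_coe_le_norm x).trans hfg.le
  obtain ⟨M₀, hM₀⟩ := Metric.tendsto_atTop.1 (hspan g hg) (ε / 3) (by positivity)
  refine ⟨M₀, fun M hM => ?_⟩
  have h1 := norm_rotAvg_sub_le (θ := θ) M (by positivity : 0 ≤ ε / 3) hle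
  have h2 : ‖(∫ x, g x) - ∫ x, f x‖ ≤ ε / 3 := by
    rw [← integral_sub (hint g) (hint f)]
    refine (norm_integral_le_of_norm_le_const (C := ε / 3) (ae_of_all _ fun x => ?_)).trans ?_
    · rw [norm_sub_rev]; exact hle x
    · simp [measureReal_def]
  have h3 := hM₀ M hM
  rw [dist_eq_norm] at h3 ⊢
  calc ‖rotAvg θ M f - ∫ x, f x‖ = ‖(rotAvg θ M f - rotAvg θ M g) +
        (rotAvg θ M g - ∫ x, g x) + ((∫ x, g x) - ∫ x, f x)‖ := by congr 1; ring
    _ < ε := (norm_add₃_le).trans_lt (by linarith)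

/-- The uniform probability measure on the points `θ, 2θ, ..., (M + 1)θ` of the circle. -/
noncomputable def rotMeasure (θ : ℝ) (M : ℕ) : Measure UnitAddCircle :=
  ((M + 1 : ℕ) : ENNReal)⁻¹ •
    ∑ n ∈ Finset.range (M + 1), Measure.dirac (((n + 1 : ℕ) * θ : ℝ) : UnitAddCircle)

instance (θ : ℝ) (M : ℕ) : IsProbabilityMeasure (rotMeasure θ M) := by
  constructor
  simp only [rotMeasure, Measure.smul_apply, Measure.finsetSum_apply, measure_univ,
    Finset.sum_const, Finset.card_range, smul_eq_mul, nsmul_eq_mul, mul_one]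
  exact ENNReal.inv_mul_cancel (by simp) (ENNReal.natCast_ne_top _)

lemma integral_rotMeasure (θ : ℝ) (M : ℕ) (f : C(UnitAddCircle, ℂ)) :
    ∫ x, f x ∂(rotMeasure θ M) = rotAvg θ (M + 1) f := by
  rw [rotMeasure, integral_smul_measure, integral_finsetSum_measure]
  · simp [rotAvg, ENNReal.toReal_add]
  · intro n _
    exact integrable_dirac (by simp)

instance : IsProbabilityMeasure (volume : Measure UnitAddCircle) := ⟨UnitAddCircle.measure_univ⟩

/-- Weak convergence passes to arcs because their boundary is null. -/
lemma tendsto_rotMeasure_closedBall {θ : ℝ} (hθ : Irrational θ) (c : UnitAddCircle) (r : ℝ) :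
    Tendsto (fun M => rotMeasure θ M (Metric.closedBall c r)) atTop
      (𝓝 (ENNReal.ofReal (min 1 (2 * r)))) := by
  let μ : ℕ → ProbabilityMeasure UnitAddCircle := fun M => ⟨rotMeasure θ M, inferInstance⟩
  let ν : ProbabilityMeasure UnitAddCircle := ⟨volume, inferInstance⟩
  have hweak : Tendsto μ atTop (𝓝 ν) := by
    rw [ProbabilityMeasure.tendsto_iff_forall_integral_rclike_tendsto ℂ]
    intro f
    refine ((tendsto_rotAvg hθ f.toContinuousMap).comp (tendsto_add_atTop_nat 1)).congr fun M => ?_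
    exact (integral_rotMeasure θ M f.toContinuousMap).symm
  have hfr : (volume : Measure UnitAddCircle) (frontier (Metric.closedBall c r)) = 0 := by
    refine measure_mono_null (t := Metric.closedBall c r \ Metric.ball c r) ?_ ?_
    · rw [frontier, Metric.isClosed_closedBall.closure_eq]
      exact Set.sdiff_subset_sdiff_right Metric.ball_subset_interior_closedBall
    · exact ae_le_set.1 (AddCircle.closedBall_ae_eq_ball (T := 1)).le
  have := ProbabilityMeasure.tendsto_measure_of_null_frontier_of_tendsto' hweak hfr
  have hvol : (ν : Measure UnitAddCircle) (Metric.closedBall c r) =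
      ENNReal.ofReal (min 1 (2 * r)) := AddCircle.volume_closedBall 1 r
  rwa [hvol] at this

open scoped Classical in
/-- The proportion of the `n` in `{1, ..., M}` that satisfy `P`. -/
noncomputable def freq (P : ℕ → Prop) (M : ℕ) : ℝ := (((Finset.Icc 1 M).filter P).card : ℝ) / M

lemma hasProb_iff {P : ℕ → Prop} {p : ℝ} : HasProb P p ↔ Tendsto (freq P) atTop (𝓝 p) := Iff.rfl

open scoped Classical in
lemma rotMeasure_apply (θ : ℝ) (M : ℕ) {E : Set UnitAddCircle} (hE : MeasurableSet E) :
    (rotMeasure θ M E).toReal = freq (fun n => ((n * θ : ℝ) : UnitAddCircle) ∈ E) (M + 1) := by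
  simp only [rotMeasure, Measure.smul_apply, Measure.finsetSum_apply, smul_eq_mul,
    Measure.dirac_apply' _ hE, ENNReal.toReal_mul, ENNReal.toReal_inv, ENNReal.toReal_natCast]
  rw [freq, div_eq_inv_mul, Finset.card_filter, ← Finset.Ico_add_one_right_eq_Icc,
    Finset.sum_Ico_eq_sum_range, ENNReal.toReal_sum fun n _ => ?_]
  · congr 1
    rw [Nat.add_sub_cancel]
    push_cast
    refine Finset.sum_congr rfl fun n _ => ?_
    rw [add_comm (n : ℝ) 1, Set.indicator_apply]
    split_ifs <;> simp
  · rw [Set.indicator_apply]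
    split_ifs <;> simp

/-- Weyl's theorem: the multiples of an irrational number are equidistributed modulo one. -/
lemma hasProb_norm_sub_le {θ : ℝ} (hθ : Irrational θ) (c r : ℝ) :
    HasProb (fun n => |n * θ - c - round (n * θ - c)| ≤ r) (max 0 (min 1 (2 * r))) := by
  rw [hasProb_iff, ← tendsto_add_atTop_iff_nat 1]
  have h := (ENNReal.continuousAt_toReal ENNReal.ofReal_ne_top).tendsto.comp
    (tendsto_rotMeasure_closedBall hθ c r)
  -- The maximum with `0` covers negative radii, which occur when an arc of length zero is shrunk.
  rw [ENNReal.toReal_ofReal', max_comm] at h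
  refine h.congr fun M => ?_
  rw [Function.comp_apply, rotMeasure_apply _ _ Metric.isClosed_closedBall.measurableSet]
  congr 1
  ext n
  rw [Metric.mem_closedBall, dist_eq_norm, ← AddCircle.coe_sub, UnitAddCircle.norm_eq]

/-! ### Logarithmic distribution of the powers of a real number -/

open scoped Classical in
lemma exists_freq_le {P Q : ℕ → Prop} (h : ∀ᶠ n in atTop, P n → Q n) :
    ∃ C : ℝ, ∀ M, freq P M ≤ freq Q M + C / M := by
  obtain ⟨n₀, hn₀⟩ := eventually_atTop.1 h
  refine ⟨n₀, fun M => ?_⟩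
  rw [freq, freq, ← add_div]
  gcongr
  have hsub : (Finset.Icc 1 M).filter P ⊆ (Finset.Icc 1 M).filter Q ∪ Finset.range n₀ := by
    intro n hn
    rw [Finset.mem_filter] at hn
    rw [Finset.mem_union, Finset.mem_filter, Finset.mem_range]
    by_cases hlt : n < n₀
    · exact Or.inr hlt
    · exact Or.inl ⟨hn.1, hn₀ n (not_lt.1 hlt) hn.2⟩
  have := (Finset.card_le_card hsub).trans (Finset.card_union_le _ _)
  rw [Finset.card_range] at this
  exact_mod_cast this

/-- The arc is only reached asymptotically, so the event is trapped between slightly smaller and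
larger arcs, up to finitely many `n`. -/
lemma hasProb_of_sandwich {P : ℕ → Prop} {p : ℝ}
    (h : ∀ η : ℝ, 0 < η → ∃ (P₁ P₂ : ℕ → Prop) (p₁ p₂ : ℝ), (∀ᶠ n in atTop, P₁ n → P n) ∧
      (∀ᶠ n in atTop, P n → P₂ n) ∧ HasProb P₁ p₁ ∧ HasProb P₂ p₂ ∧ p - η ≤ p₁ ∧ p₂ ≤ p + η) :
    HasProb P p := by
  rw [hasProb_iff]
  refine tendsto_order.2 ⟨fun a ha => ?_, fun a ha => ?_⟩
  · obtain ⟨P₁, -, p₁, -, h1, -, h3, -, h5, -⟩ := h ((p - a) / 2) (by linarith)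
    obtain ⟨C, hC⟩ := exists_freq_le h1
    have hlim : Tendsto (fun M : ℕ => freq P₁ M - C / M) atTop (𝓝 (p₁ - 0)) :=
      (hasProb_iff.1 h3).sub (tendsto_const_div_atTop_nhds_zero_nat C)
    filter_upwards [hlim.eventually (lt_mem_nhds (show a < p₁ - 0 by linarith))] with M hM
    linarith [hC M]
  · obtain ⟨-, P₂, -, p₂, -, h2, -, h4, -, h6⟩ := h ((a - p) / 2) (by linarith)
    obtain ⟨C, hC⟩ := exists_freq_le h2
    have hlim : Tendsto (fun M : ℕ => freq P₂ M + C / M) atTop (𝓝 (p₂ + 0)) :=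
      (hasProb_iff.1 h4).add (tendsto_const_div_atTop_nhds_zero_nat C)
    filter_upwards [hlim.eventually (gt_mem_nhds (show p₂ + 0 < a by linarith))] with M hM
    linarith [hC M]

lemma tendsto_logb_sub {ψ X : ℝ} (hψ : 1 < ψ) (hX : 0 < X) {x : ℕ → ℕ}
    (hx : Tendsto (fun j => (x j : ℝ) / ψ ^ j) atTop (𝓝 X)) :
    (∀ᶠ j in atTop, (0 : ℝ) < x j) ∧
      Tendsto (fun j : ℕ => Real.logb ψ (x j) - j) atTop (𝓝 (Real.logb ψ X)) := by
  have hψ0 : 0 < ψ := by linarith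
  have hpos : ∀ᶠ j in atTop, (0 : ℝ) < x j := by
    filter_upwards [hx.eventually (lt_mem_nhds hX)] with j hj
    by_contra hle
    have : (x j : ℝ) = 0 := le_antisymm (not_lt.1 hle) (Nat.cast_nonneg _)
    rw [this, zero_div] at hj
    exact lt_irrefl _ hj
  refine ⟨hpos, ?_⟩
  have hlog := hx.log hX.ne'
  refine (hlog.div_const (Real.log ψ)).congr' ?_
  filter_upwards [hpos] with j hj
  have hl : Real.log ψ ≠ 0 := (Real.log_pos hψ).ne'
  rw [Real.log_div hj.ne' (by positivity), Real.log_pow, Real.logb]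
  field_simp

lemma hasProb_exists_floor_pow_mem {ψ γ : ℝ} (hψ : 1 < ψ) (hγ : 1 < γ)
    (hirr : Irrational (Real.logb ψ γ)) {x y : ℕ → ℕ} {X Y : ℝ} (hX : 0 < X) (hXY : X ≤ Y)
    (hYX : Y ≤ ψ * X) (hx : Tendsto (fun j => (x j : ℝ) / ψ ^ j) atTop (𝓝 X))
    (hy : Tendsto (fun j => (y j : ℝ) / ψ ^ j) atTop (𝓝 Y)) :
    HasProb (fun n => ∃ j, x j ≤ ⌊γ ^ n⌋₊ ∧ ⌊γ ^ n⌋₊ < y j) (Real.logb ψ (Y / X)) := by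
  have hY : 0 < Y := hX.trans_le hXY
  have hψ0 : 0 < ψ := by linarith
  have hγ0 : 0 < γ := by linarith
  have hγn : ∀ n : ℕ, 0 < γ ^ n := fun n => pow_pos hγ0 n
  have hθ : 0 < Real.logb ψ γ := Real.logb_pos hψ hγ
  set θ := Real.logb ψ γ with hθdef
  have hlogpow : ∀ n : ℕ, Real.logb ψ (γ ^ n) = n * θ := fun n => Real.logb_pow _ _ _
  set A := Real.logb ψ X with hA
  set B := Real.logb ψ Y with hB
  have hAB : A ≤ B := Real.logb_le_logb_of_le hψ hX hXY
  have hBA : B ≤ A + 1 := by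
    have := Real.logb_le_logb_of_le hψ hY hYX
    rw [Real.logb_mul hψ0.ne' hX.ne', Real.logb_self_eq_one hψ] at this
    linarith
  rw [Real.logb_div hY.ne' hX.ne', ← hA, ← hB]
  obtain ⟨hxpos, hxlim⟩ := tendsto_logb_sub hψ hX hx
  obtain ⟨hypos, hylim⟩ := tendsto_logb_sub hψ hY hy
  refine hasProb_of_sandwich fun η hη => ?_
  -- Moving both ends of an arc by `δ` changes its length by `2δ = η`.
  set δ := η / 2 with hδ
  have hδ0 : 0 < δ := by positivity
  set c := (A + B) / 2 with hc
  set r := (B - A) / 2 with hr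
  obtain ⟨j₀, hj₀⟩ : ∃ j₀, ∀ j ≥ j₀, (0 : ℝ) < x j ∧ (0 : ℝ) < y j ∧
      |Real.logb ψ (x j) - j - A| < δ ∧ |Real.logb ψ (y j) - j - B| < δ := by
    refine eventually_atTop.1 ?_
    filter_upwards [hxpos, hypos, Metric.tendsto_nhds.1 hxlim δ hδ0,
      Metric.tendsto_nhds.1 hylim δ hδ0] with j h1 h2 h3 h4
    exact ⟨h1, h2, h3, h4⟩
  refine ⟨_, _, _, _, ?_, ?_, hasProb_norm_sub_le hirr c (r - δ),
    hasProb_norm_sub_le hirr c (r + δ), ?_, ?_⟩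
  · have htop : Tendsto (fun n : ℕ => (n : ℝ) * θ) atTop atTop :=
      tendsto_natCast_atTop_atTop.atTop_mul_const hθ
    -- For such `n` the nearest integer to `nθ - c` is at least `j₀` and serves as the index `j`.
    filter_upwards [htop.eventually_ge_atTop (c + j₀ + 1)] with n hn hround
    have hhalf := abs_le.1 (abs_sub_round (n * θ - c))
    have hm : (j₀ : ℝ) ≤ round (n * θ - c) := by linarith [hhalf.2]
    have hm' : (j₀ : ℤ) ≤ round (n * θ - c) := by exact_mod_cast hm
    obtain ⟨j, hj⟩ := Int.eq_ofNat_of_zero_le ((Int.natCast_nonneg j₀).trans hm')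
    rw [hj] at hround hm'
    obtain ⟨h1, h2, h3, h4⟩ := hj₀ j (by exact_mod_cast hm')
    rw [abs_lt] at h3 h4
    rw [abs_le, Int.cast_natCast] at hround
    refine ⟨j, Nat.le_floor ?_, (Nat.floor_lt (hγn n).le).2 ?_⟩
    · refine (Real.logb_le_logb hψ h1 (hγn n)).1 ?_
      rw [hlogpow]
      linarith [hround.1, h3.2]
    · refine (Real.logb_lt_logb_iff hψ (hγn n) h2).1 ?_
      rw [hlogpow]
      linarith [hround.2, h4.1]
  -- Eventually `γ ^ n` outgrows the finitely many intervals with `j < j₀`. For the remaining `j`,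
  -- the nearest integer is at least as close as `j`.
  · have hsmall : ∀ᶠ n : ℕ in atTop, ∀ j ∈ Finset.range j₀, (y j : ℝ) ≤ γ ^ n :=
      (eventually_all_finset _).2 fun j _ =>
        (tendsto_pow_atTop_atTop_of_one_lt hγ).eventually_ge_atTop _
    filter_upwards [hsmall] with n hn
    rintro ⟨j, hj1, hj2⟩
    have hle : (x j : ℝ) ≤ γ ^ n := (Nat.le_floor_iff (hγn n).le).1 hj1
    have hlt : γ ^ n < y j := (Nat.floor_lt (hγn n).le).1 hj2
    have hj : j₀ ≤ j := by
      by_contra hlt'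
      exact absurd hlt (not_lt.2 (hn j (Finset.mem_range.2 (not_le.1 hlt'))))
    obtain ⟨h1, h2, h3, h4⟩ := hj₀ j hj
    rw [abs_lt] at h3 h4
    have e1 := (Real.logb_le_logb hψ h1 (hγn n)).2 hle
    have e2 := (Real.logb_lt_logb_iff hψ (hγn n) h2).2 hlt
    rw [hlogpow] at e1 e2
    refine (round_le (n * θ - c) (j : ℤ)).trans (abs_le.2 ⟨?_, ?_⟩) <;> rw [Int.cast_natCast]
    · linarith [h3.1]
    · linarith [h4.2]
  -- The arc has length `B - A ≤ 1`, so it does not overlap itself on the circle.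
  · refine le_max_of_le_right (le_min ?_ ?_) <;> linarith
  · refine max_le ?_ ((min_le_right _ _).trans ?_) <;> linarith

/-! ### Strong Benford's Law -/

lemma dot_append_zeros (β : List ℕ) (n : ℕ) (Q : ℕ → ℝ) :
    dot (β ++ List.replicate n 0) Q = dot β Q := by
  have h : ∀ k, (β ++ List.replicate n 0).getD k 0 = β.getD k 0 := by
    intro k
    rcases lt_or_ge k β.length with hk | hk
    · exact List.getD_append _ _ _ _ hk
    · rw [List.getD_append_right _ _ _ _ hk, List.getD_eq_default _ _ hk,
        List.getD_eq_getElem?_getD, List.getElem?_replicate]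
      split_ifs <;> rfl
  unfold dot
  simp only [h]
  symm
  refine Finset.sum_subset (fun k hk => ?_) fun k _ hk => ?_
  · rw [Finset.mem_range] at hk ⊢
    rw [List.length_append]; omega
  · rw [Finset.mem_range, not_lt] at hk
    rw [List.getD_eq_default _ _ hk, Nat.cast_zero, zero_mul]

/-- The equation for `ψ` evaluates one period; later periods are its multiples by powers of `ψ⁻¹ ^
N`, and the sum telescopes. -/
lemma sum_theta_mul_pow {L : List ℕ} (hL : IsPrincipalMaximalBlock L) {ψ : ℝ} (hψ : 1 < ψ)
    (h0 : Polynomial.aeval ψ (charPoly L) = 0) (q : ℕ) :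
    ∑ k ∈ Finset.range (L.length * q), (theta L k : ℝ) * ψ⁻¹ ^ k =
      ψ - ψ * ψ⁻¹ ^ (L.length * q) := by
  have hN : 0 < L.length := by have := hL.1; omega
  have hψ0 : ψ ≠ 0 := by linarith
  have hbase : ∑ k ∈ Finset.range L.length, (theta L k : ℝ) * ψ⁻¹ ^ k =
      ψ - ψ * ψ⁻¹ ^ L.length := by
    have h1 := sum_weight hL hψ h0
    simp only [weight] at h1
    rw [sum_recCoeff_mul hN (fun j => ψ⁻¹ ^ (j + 1)), Nat.sub_add_cancel hN] at h1
    have h2 : ∑ k ∈ Finset.range L.length, (theta L k : ℝ) * ψ⁻¹ ^ k =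
        ψ * ∑ k ∈ Finset.range L.length, (L.getD k 0 : ℝ) * ψ⁻¹ ^ (k + 1) := by
      rw [Finset.mul_sum]
      refine Finset.sum_congr rfl fun k hk => ?_
      rw [theta_of_lt (Finset.mem_range.1 hk), pow_succ]
      field_simp
    rw [h2, eq_sub_of_add_eq h1]
    ring
  induction q with
  | zero => simp
  | succ q ih =>
    rw [Nat.mul_succ, add_comm, Finset.sum_range_add, hbase]
    simp only [theta_length_add, pow_add, mul_left_comm _ (ψ⁻¹ ^ L.length)]
    rw [← Finset.mul_sum, ih]
    ring

/-- Full periods of `Θ` fall short of `ψ` by exactly the weight of their last place, which the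
increment supplies. -/
lemma dot_exclusiveBlock {L : List ℕ} (hL : IsPrincipalMaximalBlock L) {ψ : ℝ} (hψ : 1 < ψ)
    (h0 : Polynomial.aeval ψ (charPoly L) = 0) (s : ℕ) :
    dot (exclusiveBlock L s) (hatSeq ψ) = ψ := by
  have hN : 0 < L.length := by have := hL.1; omega
  have hψ0 : ψ ≠ 0 := by linarith
  obtain ⟨q, hq⟩ : ∃ q, max s L.length / L.length = q + 1 :=
    ⟨_, (Nat.sub_add_cancel (Nat.div_pos (le_max_right _ _) hN)).symm⟩
  obtain ⟨m, hm⟩ : ∃ m, L.length * (q + 1) = m + 1 :=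
    ⟨_, (Nat.sub_add_cancel (Nat.mul_pos hN (Nat.succ_pos q))).symm⟩
  have hlast : theta L m = L.getD (L.length - 1) 0 := by
    have : m = L.length * q + (L.length - 1) := by
      rw [Nat.mul_succ] at hm; omega
    rw [theta, this, Nat.mul_add_mod, Nat.mod_eq_of_lt (by omega)]
  have hkey := sum_theta_mul_pow hL hψ h0 (q + 1)
  rw [hm, Finset.sum_range_succ, hlast] at hkey
  have hsplit : exclusiveBlock L s = (thetaTrunc L m ++ [1 + L.getD (L.length - 1) 0]) ++
      List.replicate (max s L.length % L.length) 0 := by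
    rw [exclusiveBlock, hq, hm]
    simp
  rw [hsplit, dot_append_zeros, dot, List.length_append, length_thetaTrunc, List.length_singleton,
    Finset.sum_range_succ]
  have hget : ∀ k ∈ Finset.range m,
      (((thetaTrunc L m ++ [1 + L.getD (L.length - 1) 0]).getD k 0 : ℕ) : ℝ) * hatSeq ψ k =
        (theta L k : ℝ) * ψ⁻¹ ^ k := by
    intro k hk
    rw [Finset.mem_range] at hk
    rw [List.getD_append _ _ _ _ (by rwa [length_thetaTrunc]), hatSeq]
    simp [thetaTrunc, hk, List.getD_eq_getElem?_getD]
  rw [Finset.sum_congr rfl hget, List.getD_append_right _ _ _ _ (by rw [length_thetaTrunc]),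
    length_thetaTrunc, Nat.sub_self, List.getD_cons_zero, hatSeq]
  push_cast
  have : ψ * ψ⁻¹ ^ (m + 1) = ψ⁻¹ ^ m := by
    rw [pow_succ]; field_simp
  rw [this] at hkey
  linarith

/-- The padded block is a fixed finite combination of shifted terms of `H`, so the limit is taken
term by term. -/
lemma tendsto_blockStart_div {L : List ℕ} {ψ α : ℝ} (hψ : 1 < ψ)
    (hα : Tendsto (fun t => (fundSeq L t : ℝ) / ψ ^ t) atTop (𝓝 α)) (β : List ℕ) :
    Tendsto (fun j => (blockStart L β j : ℝ) / ψ ^ j) atTop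
      (𝓝 (α * ψ ^ (β.length - 1) * dot β (hatSeq ψ))) := by
  have hψ0 : 0 < ψ := by linarith
  have hterm : ∀ k ∈ Finset.range β.length, Tendsto
      (fun j => (β.getD k 0 : ℝ) * ψ ^ (β.length - 1 - k) *
        ((fundSeq L (j + (β.length - 1 - k)) : ℝ) / ψ ^ (j + (β.length - 1 - k)))) atTop
      (𝓝 ((β.getD k 0 : ℝ) * ψ ^ (β.length - 1 - k) * α)) := fun k _ =>
    (hα.comp (tendsto_add_atTop_nat (β.length - 1 - k))).const_mul _
  have hlim := tendsto_finsetSum _ hterm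
  have he : ∑ k ∈ Finset.range β.length, (β.getD k 0 : ℝ) * ψ ^ (β.length - 1 - k) * α =
      α * ψ ^ (β.length - 1) * dot β (hatSeq ψ) := by
    rw [dot, Finset.mul_sum]
    refine Finset.sum_congr rfl fun k hk => ?_
    rw [Finset.mem_range] at hk
    have : ψ ^ (β.length - 1) = ψ ^ (β.length - 1 - k) * ψ ^ k := by
      rw [← pow_add]; congr 1; omega
    rw [this, hatSeq, inv_pow]
    field_simp
  rw [he] at hlim
  refine hlim.congr fun j => ?_
  rw [blockStart, conv_append, conv_replicate_zero, add_zero, List.length_replicate, conv]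
  push_cast
  rw [Finset.sum_div]
  refine Finset.sum_congr rfl fun k _ => ?_
  rw [add_comm j, pow_add]
  field_simp

lemma tendsto_blockEnd_div {L : List ℕ} (hL : IsPrincipalMaximalBlock L) {ψ α : ℝ} (hψ : 1 < ψ)
    (h0 : Polynomial.aeval ψ (charPoly L) = 0)
    (hα : Tendsto (fun t => (fundSeq L t : ℝ) / ψ ^ t) atTop (𝓝 α)) {s : ℕ} (hs : 1 ≤ s)
    {b : List ℕ} (hb : b ∈ blocks L (fundSeq L) s) :
    Tendsto (fun j => (blockEnd L s b j : ℝ) / ψ ^ j) atTop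
      (𝓝 (α * ψ ^ (s - 1) * dot (tilde L (fundSeq L) s b) (hatSeq ψ))) := by
  have hψ0 : 0 < ψ := by linarith
  unfold blockEnd
  split_ifs with h
  · rw [tilde_of_eq hs h, dot_exclusiveBlock hL hψ h0, mul_assoc, ← pow_succ,
      Nat.sub_add_cancel hs, mul_comm]
    refine ((hα.comp (tendsto_add_atTop_nat s)).const_mul (ψ ^ s)).congr fun j => ?_
    rw [Function.comp_apply, add_comm j, pow_add]
    field_simp
  · obtain ⟨hz, hl, -⟩ := blocks_spec hs (tilde_of_lt hL hs hb h).1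
    have := tendsto_blockStart_div hψ hα ((tilde L (fundSeq L) s b).take s)
    rwa [hl, ← dot_append_zeros _ (L.length - s), ← hz] at this

lemma strongBenford_floor_pow {L : List ℕ} (hL : IsPrincipalMaximalBlock L) {γ : ℝ} (hγ : 1 < γ)
    (hirr : ∀ ψ : ℝ, IsDominantRealZero L ψ → ∀ r : ℚ, γ ≠ ψ ^ (r : ℝ)) :
    StrongBenford L (fun n : ℕ => ⌊γ ^ n⌋₊) := by
  refine ⟨⟨_, isFundamentalSequence_fundSeq hL⟩, ?_, ?_⟩
  · obtain ⟨ψ, hψ, h0⟩ := exists_zero_gt_one hL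
    exact ⟨ψ, isDominantRealZero_of_one_lt hL hψ h0⟩
  · intro H hH ψ hdom s hs b hb
    obtain rfl := eq_fundSeq hL hH
    have hψ := one_lt_of_isDominantRealZero hL hdom
    have hψ0 : 0 < ψ := by linarith
    have hθ : Irrational (Real.logb ψ γ) := by
      rintro ⟨r, hr⟩
      refine hirr ψ hdom r ?_
      rw [hr, Real.rpow_logb hψ0 hψ.ne' (by linarith)]
    obtain ⟨α, hα0, hα⟩ := exists_tendsto_fundSeq_div hL hψ hdom.1
    obtain ⟨hbz, hlen, hβ⟩ := blocks_spec hs hb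
    have hx := tendsto_blockStart_div hψ hα (b.take s)
    rw [hlen, ← dot_append_zeros _ (L.length - s), ← hbz] at hx
    have hy := tendsto_blockEnd_div hL hψ hdom.1 hα hs hb
    have hκ : 0 < α * ψ ^ (s - 1) := by positivity
    -- All numbers with `s + j` digits lie in `[H_{s+j-1}, H_{s+j})`, whose ends have asymptotic
    -- ratio `ψ`; this bounds the two limits so that `Y ≤ ψ X`.
    have hlow : α * ψ ^ (s - 1) ≤ α * ψ ^ (s - 1) * dot b (hatSeq ψ) := by
      have hlim := (hα.comp (tendsto_add_atTop_nat (s - 1))).mul_const (ψ ^ (s - 1))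
      refine le_of_tendsto_of_tendsto' hlim hx fun j => ?_
      have h1 := fundSeq_le_blockStart hβ j
      rw [hlen, show s + j - 1 = j + (s - 1) by omega] at h1
      have h2 : (fundSeq L (j + (s - 1)) : ℝ) ≤ blockStart L (b.take s) j := by exact_mod_cast h1
      rw [Function.comp_apply, pow_add, ← div_div, div_mul_cancel₀ _ (by positivity)]
      gcongr
    have hup : α * ψ ^ (s - 1) * dot (tilde L (fundSeq L) s b) (hatSeq ψ) ≤
        α * ψ ^ (s - 1) * ψ := by
      rw [mul_assoc α _ ψ, ← pow_succ, Nat.sub_add_cancel hs]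
      have hlim := (hα.comp (tendsto_add_atTop_nat s)).mul_const (ψ ^ s)
      refine le_of_tendsto_of_tendsto' hy hlim fun j => ?_
      have h2 : (blockEnd L s b j : ℝ) ≤ fundSeq L (s + j) := by
        exact_mod_cast blockEnd_le hL hs hb j
      rw [Function.comp_apply, pow_add, ← div_div, div_mul_cancel₀ _ (by positivity), add_comm j]
      gcongr
    have hmid : α * ψ ^ (s - 1) * dot b (hatSeq ψ) ≤
        α * ψ ^ (s - 1) * dot (tilde L (fundSeq L) s b) (hatSeq ψ) := by
      refine le_of_tendsto_of_tendsto' hx hy fun j => ?_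
      have h1 := conv_lt_blockEnd hL hs hb
        (accepts_append_zeros (memHcirc_iff.1 hβ.1) j) (by simp only [List.length_append]; omega)
        (List.take_left' hlen)
      rw [List.length_append, hlen, List.length_replicate, Nat.add_sub_cancel_left] at h1
      have h2 : (blockStart L (b.take s) j : ℝ) ≤ blockEnd L s b j := by exact_mod_cast h1.le
      gcongr
    have key := hasProb_exists_floor_pow_mem hψ hγ hθ (hκ.trans_le hlow) hmid
      (hup.trans (by rw [mul_comm]; gcongr)) hx hy
    rw [mul_div_mul_left _ _ hκ.ne'] at key
    simpa only [lBEq_iff hL hs hb] using key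

/-! ### Absolute Benford's Law and algebraic integers -/

lemma absoluteBenford_floor_pow {γ : ℝ} (hγ : 1 < γ)
    (hirr : ∀ L : List ℕ, IsPrincipalMaximalBlock L →
      ∀ ψ : ℝ, IsDominantRealZero L ψ → ∀ r : ℚ, γ ≠ ψ ^ (r : ℝ)) :
    AbsoluteBenford (fun n : ℕ => ⌊γ ^ n⌋₊) :=
  ⟨fun _ _ => Nat.floor_pos.2 (one_le_pow₀ hγ.le),
    fun L hL => strongBenford_floor_pow hL hγ (hirr L hL)⟩

/-- Since `γ > 1` forces `r > 0`, clearing the denominator makes a power of `γ` a natural power of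
the algebraic integer `ψ`. -/
lemma isIntegral_of_eq_rpow {L : List ℕ} (hL : IsPrincipalMaximalBlock L) {ψ γ : ℝ}
    (hψ : IsDominantRealZero L ψ) (hγ : 1 < γ) {r : ℚ} (h : γ = ψ ^ (r : ℝ)) : IsIntegral ℤ γ := by
  have h1 := one_lt_of_isDominantRealZero hL hψ
  have hr : 0 < (r : ℝ) := by
    by_contra hle
    have := Real.rpow_le_one_of_one_le_of_nonpos h1.le (not_lt.1 hle)
    linarith
  have hr' : 0 < r := by exact_mod_cast hr
  have hint := isIntegral_of_aeval_charPoly_eq_zero (by have := hL.1; omega) hψ.1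
  refine IsIntegral.of_pow r.den_pos (?_ : IsIntegral ℤ (γ ^ r.den))
  have hpow : γ ^ r.den = ψ ^ r.num.toNat := by
    rw [h, ← Real.rpow_natCast, ← Real.rpow_mul (by linarith), ← Real.rpow_natCast ψ]
    congr 1
    have hnum : ((r.num.toNat : ℕ) : ℤ) = r.num := Int.toNat_of_nonneg (Rat.num_pos.2 hr').le
    have h2 : ((r.num.toNat : ℕ) : ℚ) = r.num := by exact_mod_cast hnum
    have h3 : r * r.den = (r.num.toNat : ℕ) := by rw [h2]; exact Rat.mul_den_eq_num r
    exact_mod_cast h3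
  rw [hpow]
  exact hint.pow _

lemma not_isIntegral_div : ¬ IsIntegral ℤ ((89 : ℝ) / 55) := by
  intro h
  have h2 : IsIntegral ℤ ((89 : ℚ) / 55) := by
    refine (isIntegral_algebraMap_iff (algebraMap ℚ ℝ).injective).1 ?_
    simpa using h
  obtain ⟨m, hm⟩ := IsIntegrallyClosed.isIntegral_iff.1 h2
  rw [eq_div_iff (by norm_num), eq_intCast] at hm
  have h3 : m * 55 = 89 := by exact_mod_cast hm
  omega

end GenZeckendorf

theorem theorem5p12 :
    (∀ γ : ℝ, 1 < γ →
      (∀ L : List ℕ, GenZeckendorf.IsPrincipalMaximalBlock L →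
        ∀ ψ : ℝ, GenZeckendorf.IsDominantRealZero L ψ → ∀ r : ℚ, γ ≠ ψ ^ (r : ℝ)) →
      GenZeckendorf.AbsoluteBenford (fun n : ℕ => ⌊γ ^ n⌋₊)) ∧
    (∀ γ : ℝ, 1 < γ → ¬ IsIntegral ℤ γ →
      GenZeckendorf.AbsoluteBenford (fun n : ℕ => ⌊γ ^ n⌋₊)) ∧
    GenZeckendorf.AbsoluteBenford (fun n : ℕ => ⌊((89 : ℝ) / 55) ^ n⌋₊) := by
  have hii : ∀ γ : ℝ, 1 < γ → ¬ IsIntegral ℤ γ →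
      GenZeckendorf.AbsoluteBenford (fun n : ℕ => ⌊γ ^ n⌋₊) := fun γ hγ hint =>
    GenZeckendorf.absoluteBenford_floor_pow hγ fun L hL ψ hψ r h =>
      hint (GenZeckendorf.isIntegral_of_eq_rpow hL hψ hγ h)
  exact ⟨fun γ hγ h => GenZeckendorf.absoluteBenford_floor_pow hγ h, hii,
    hii _ (by norm_num) GenZeckendorf.not_isIntegral_div⟩
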